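/- Let $\mathcal G$ be a finite groupoid with unit space $\mathcal G^0$, source $s$ and range $r$ ($xy$ is defined iff $s(x)=r(y)$), and let $C(\mathcal G)$ act on $l^2(\mathcal G)$ by multiplication. Put $\Gamma(f)(x,y)=f(xy)$ if $s(x)=r(y)$ and $0$ otherwise, $\kappa(f)(x)=f(x^{-1})$, $(\rho(x)\xi)(t)=\xi(tx)$ if $s(t)=r(x)$ and $0$ otherwise, and $\mathcal R(\mathcal G)=\operatorname{span}\{\rho(x)\}$. Let $A$ be a von Neumann algebra on a Hilbert space $H$, and let $b:C(\mathcal G^0)\to A$ be an injective unital $*$-homomorphism. Put $e_b=\sum_{u\in\mathcal G^0} b(\delta_u)\otimes(\delta_u\circ r)$, where $\delta_u$ is the Dirac function at $u$. A right action of $(C(\mathcal G),\Gamma,\kappa)$ on $(A,b)$ is an injective normal (not necessarily unital) $*$-homomorphism $\delta:A\to A\otimes C(\mathcal G)$ such that $(\delta\otimes\mathrm{id})\delta=(\mathrm{id}\otimes\Gamma)\delta$ and $\delta(b(n))=e_b\,(1\otimes\kappa(n\circ r))$ for all $n\in C(\mathcal G^0)$. Its crossed product $A\rtimes_\delta C(\mathcal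 G)$ is the von Neumann algebra generated in $\mathcal L(H\otimes l^2(\mathcal G))$ by $\delta(A)$ and $e_b(1\otimes\mathcal R(\mathcal G))$; generated von Neumann algebras are weakly closed $*$-algebras whose unit may be a proper projection. Define a partial isometry $\tilde I$ on $l^2(\mathcal G\times\mathcal G)$ by $(\tilde I\xi)(x,y)=\xi(x,yx^{-1})$ if $s(x)=s(y)$ and $0$ otherwise, and put $\hat\delta(X)=\tilde I_{23}(X\otimes 1)\tilde I_{23}^*$, $\hat b(n)=e_b(1\otimes (n\circ s))$ and $\hat e=\sum_{u}\hat b(\delta_u)\otimes(\delta_u\circ s)$. The double crossed product $(A\rtimes_\delta C(\mathcal G))\,\hat\rtimes_{\hat\delta}\,\mathcal R(\mathcal G)$ is the von Neumann algebra generated by $\hat\delta(A\rtimes_\delta C(\mathcal G))$ and $\hat e\,(1\otimes C(\mathcal G)')$, where $C(\mathcal G)'$ is the commutant of $C(\mathcal G)$ in $\mathcal L(l^2(\mathcal G))$ (it equals $C(\mathcal G)$). **Theorem.** Let $\mathcal W(\mathcal G)$ be the Weyl algebra, that is, the commutant in $\mathcal L(l^2(\mathcal G))$ of the multiplication operators $n\circ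 r$, $n\in C(\mathcal G^0)$. For every right action $\delta$ of $(C(\mathcal G),\Gamma,\kappa)$ on $(A,b)$, the von Neumann algebra $(A\rtimes_\delta C(\mathcal G))\,\hat\rtimes_{\hat\delta}\,\mathcal R(\mathcal G)$ is $*$-isomorphic to $\delta(1)(A\otimes\mathcal W(\mathcal G))\delta(1)$. Moreover $\mathcal W(\mathcal G)$ is the von Neumann algebra generated by $C(\mathcal G)$ and $\mathcal R(\mathcal G)$, and it is the linear span of the products $f\,\hat s$ with $f\in C(\mathcal G)$ and $\hat s\in\mathcal R(\mathcal G)$. -/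

import Mathlib

noncomputable section

namespace QGpd

open scoped Classical ComplexInnerProductSpace
open CategoryTheory

/-! ### Operators and (possibly degenerate) von Neumann algebras -/

/-- Bounded operators on `K`. -/
abbrev Op (K : Type*) [NormedAddCommGroup K] [InnerProductSpace ℂ K] := K →L[ℂ] K

section Generated

variable {K : Type*} [NormedAddCommGroup K] [InnerProductSpace ℂ K]

/-- A set of operators is closed in the weak operator topology. -/
def IsWOTClosed (s : Set (Op K)) : Prop :=
  IsClosed {T : K →WOT[ℂ] K | T.toCLM ∈ s}

variable [CompleteSpace K]

/-- The von Neumann algebra generated by a set `T` of operators: the smallest weakly closed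
`*`-subalgebra of `ℒ(K)` that contains `T`. Its unit is not required to be the identity of `K`. -/
def vNGen (T : Set (Op K)) : NonUnitalStarSubalgebra ℂ (Op K) :=
  sInf {M | IsWOTClosed (M : Set (Op K)) ∧ T ⊆ M}

theorem subset_vNGen (T : Set (Op K)) : T ⊆ vNGen T := by
  intro x hx
  exact NonUnitalStarAlgebra.mem_sInf.2 fun p hp => hp.2 hx

/-- The reduced algebra `e M e`, for a projection `e` of `M`. -/
def corner (M : NonUnitalStarSubalgebra ℂ (Op K)) (e : Op K) (he : IsStarProjection e)
    (heM : e ∈ M) : NonUnitalStarSubalgebra ℂ (Op K) where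
  carrier := {x | ∃ y ∈ M, x = e * y * e}
  add_mem' := by
    rintro _ _ ⟨y, hy, rfl⟩ ⟨z, hz, rfl⟩
    exact ⟨y + z, add_mem hy hz, by simp [mul_add, add_mul]⟩
  zero_mem' := ⟨0, zero_mem M, by simp⟩
  mul_mem' := by
    rintro _ _ ⟨y, hy, rfl⟩ ⟨z, hz, rfl⟩
    refine ⟨y * e * z, mul_mem (mul_mem hy heM) hz, ?_⟩
    have h : e * e = e := he.isIdempotentElem
    calc e * y * e * (e * z * e) = e * y * (e * e) * z * e := by simp only [mul_assoc]
      _ = e * (y * e * z) * e := by rw [h]; simp only [mul_assoc]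
  smul_mem' := by
    rintro c _ ⟨y, hy, rfl⟩
    exact ⟨c • y, SMulMemClass.smul_mem c hy, by simp⟩
  star_mem' := by
    rintro _ ⟨y, hy, rfl⟩
    refine ⟨star y, star_mem hy, ?_⟩
    have h : star e = e := he.isSelfAdjoint
    simp only [star_mul, h, mul_assoc]

/-- Isomorphism of von Neumann algebras: the existence of a `*`-isomorphism. -/
def VNIsomorphic {K' : Type*} [NormedAddCommGroup K'] [InnerProductSpace ℂ K'] [CompleteSpace K']
    (M : NonUnitalStarSubalgebra ℂ (Op K)) (N : NonUnitalStarSubalgebra ℂ (Op K')) : Prop :=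
  Nonempty (M ≃⋆ₐ[ℂ] N)

end Generated

section Normal

variable {H K : Type*} [NormedAddCommGroup H] [InnerProductSpace ℂ H] [CompleteSpace H]
  [NormedAddCommGroup K] [InnerProductSpace ℂ K] [CompleteSpace K]

/-- Normality of a map on a von Neumann algebra: it preserves the least upper bounds of upward
directed families of positive elements (the order is the usual order on operators). -/
def IsNormalMap (A : VonNeumannAlgebra H) (φ : A.toStarSubalgebra → Op K) : Prop :=
  ∀ (D : Set A.toStarSubalgebra) (a : A.toStarSubalgebra), D.Nonempty →
    (∀ x ∈ D, (0 : Op H) ≤ (x : Op H)) →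
    DirectedOn (fun x y : A.toStarSubalgebra => (x : Op H) ≤ (y : Op H)) D →
    IsLUB ((fun x : A.toStarSubalgebra => (x : Op H)) '' D) (a : Op H) → IsLUB (φ '' D) (φ a)

end Normal

/-! ### Tensor products with `l²(G)` for a finite set `G` -/

/-- The Hilbert space `l²(G)`. -/
abbrev l2 (G : Type*) [Fintype G] := EuclideanSpace ℂ G

/-- The Hilbert space `K ⊗ l²(G) = l²(G; K)`, where `k ⊗ ε_g` is the family that is `k` at `g`
and `0` elsewhere. -/
abbrev Amp (K G : Type*) [Fintype G] := PiLp 2 (fun _ : G => K)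

section Tensor

variable {K G : Type*} [NormedAddCommGroup K] [InnerProductSpace ℂ K] [Fintype G]

/-- The operator on `K ⊗ l²(G)` with operator matrix `m`. -/
def blockOp (m : G → G → Op K) : Op (Amp K G) :=
  ((PiLp.continuousLinearEquiv 2 ℂ (fun _ : G => K)).symm : (G → K) →L[ℂ] Amp K G) ∘L
    ContinuousLinearMap.pi fun g =>
      ∑ h, m g h ∘L (PiLp.proj 2 (fun _ : G => K) h : Amp K G →L[ℂ] K)

@[simp] theorem blockOp_apply (m : G → G → Op K) (ξ : Amp K G) (g : G) :
    blockOp m ξ g = ∑ h, m g h (ξ h) := by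
  simp [blockOp]

/-- Matrix coefficient of an operator on `l²(G)`. -/
def entry (T : Op (l2 G)) (g h : G) : ℂ := T (EuclideanSpace.single h 1) g

/-- The operator `x ⊗ T` on `K ⊗ l²(G)`. -/
def tens (x : Op K) (T : Op (l2 G)) : Op (Amp K G) := blockOp fun g h => entry T g h • x

/-- A linear map on functions, as an operator on `l²(G)`. -/
def opOf {G : Type*} [Fintype G] (f : (G → ℂ) →ₗ[ℂ] (G → ℂ)) : Op (l2 G) :=
  LinearMap.toContinuousLinearMap
    ((WithLp.linearEquiv 2 ℂ (G → ℂ)).symm.toLinearMap ∘ₗ f ∘ₗ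
      (WithLp.linearEquiv 2 ℂ (G → ℂ)).toLinearMap)

theorem opOf_apply {G : Type*} [Fintype G] (f : (G → ℂ) →ₗ[ℂ] (G → ℂ)) (ξ : l2 G) (g : G) :
    opOf f ξ g = f ξ g := rfl

/-- Multiplication by the function `f` on `l²(G)`. -/
def mulOp (f : G → ℂ) : Op (l2 G) :=
  opOf
    { toFun := fun ξ g => f g * ξ g
      map_add' := fun ξ η => by ext g; simp [mul_add]
      map_smul' := fun c ξ => by ext g; simp [mul_left_comm] }

@[simp] theorem mulOp_apply (f : G → ℂ) (ξ : l2 G) (g : G) : mulOp f ξ g = f g * ξ g := rfl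

/-- The Dirac function at `g`. -/
def dirac {X : Type*} (g : X) : X → ℂ := fun h => if h = g then 1 else 0

/-- The identification of `C(G, A) = A ⊗ C(G)` with operators on `K ⊗ l²(G)`:
`F ↦ ∑ F(g) ⊗ δ_g`. -/
def funOp (F : G → Op K) : Op (Amp K G) := ∑ g, tens (F g) (mulOp (dirac g))

/-- `T₂₃ = 1 ⊗ T` on `(K ⊗ l²(G)) ⊗ l²(G)`, for an operator `T` on `l²(G × G) = l²(G) ⊗ l²(G)`. -/
def leg23 (T : Op (l2 (G × G))) : Op (Amp (Amp K G) G) :=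
  blockOp fun y y' => blockOp fun x x' => entry T (x, y) (x', y') • (1 : Op K)

/-- The von Neumann tensor product of `A ⊆ ℒ(K)` and `M ⊆ ℒ(l²(G))`: the von Neumann algebra
on `K ⊗ l²(G)` generated by the `a ⊗ T`. -/
def vNTensor [CompleteSpace K] (A : Set (Op K)) (M : Set (Op (l2 G))) :
    NonUnitalStarSubalgebra ℂ (Op (Amp K G)) :=
  vNGen {X | ∃ a ∈ A, ∃ T ∈ M, X = tens a T}

theorem funOp_apply (F : G → Op K) (ξ : Amp K G) (g : G) : funOp F ξ g = F g (ξ g) := by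
  have h1 : ∀ i x : G, entry (mulOp (dirac i)) g x = if g = i ∧ g = x then 1 else 0 := by
    intro i x
    by_cases h : g = i <;> by_cases h' : g = x <;> simp [entry, dirac, h, h']
  have h2 : funOp F ξ g = ∑ i, ∑ x, (if g = i ∧ g = x then F i (ξ x) else 0) := by
    simp only [funOp, tens, sum_apply, WithLp.ofLp_sum, Finset.sum_apply, blockOp_apply, h1]
    refine Finset.sum_congr rfl fun i _ => Finset.sum_congr rfl fun x _ => ?_
    split_ifs <;> simp
  rw [h2]
  simp [ite_and]

theorem funOp_mul (F F' : G → Op K) : funOp (F * F') = funOp F * funOp F' := by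
  ext ξ g
  simp [funOp_apply]

theorem funOp_star [CompleteSpace K] (F : G → Op K) : funOp (star F) = star (funOp F) := by
  rw [ContinuousLinearMap.star_eq_adjoint, ContinuousLinearMap.eq_adjoint_iff]
  intro ξ η
  simp [PiLp.inner_apply, funOp_apply, ContinuousLinearMap.star_eq_adjoint,
    ContinuousLinearMap.adjoint_inner_left]

end Tensor

/-! ### Finite groupoids -/

/-- The morphisms `s ⟶ r` of a groupoid with set of objects (units) `V`. -/
structure Mor (V : Type*) [Groupoid V] where
  s : V
  r : V
  hom : s ⟶ r

namespace Mor

variable {V : Type*} [Groupoid V]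

/-- The product `x y`, defined when `s(x) = r(y)` (first `y`, then `x`). -/
def comp (x y : Mor V) (h : x.s = y.r) : Mor V := ⟨y.s, x.r, y.hom ≫ eqToHom h.symm ≫ x.hom⟩

/-- The inverse `x⁻¹`. -/
def inv (x : Mor V) : Mor V := ⟨x.r, x.s, Groupoid.inv x.hom⟩

variable [Finite V] [∀ u v : V, Finite (u ⟶ v)]

instance : Finite (Mor V) :=
  Finite.of_injective (β := Σ p : V × V, (p.1 ⟶ p.2)) (fun x => ⟨(x.s, x.r), x.hom⟩) (by
    rintro ⟨s, r, f⟩ ⟨s', r', f'⟩ h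
    obtain ⟨h1, h2⟩ := Sigma.mk.inj h
    obtain ⟨rfl, rfl⟩ := Prod.mk.inj h1
    cases h2
    rfl)

instance : Fintype (Mor V) := Fintype.ofFinite _

end Mor

section Groupoid

variable (V : Type*) [Groupoid V] [Finite V] [∀ u v : V, Finite (u ⟶ v)]

variable {V} in
/-- The coproduct `Γ(f)(x, y) = f(xy)` if `x, y` are composable, and `0` otherwise. For values in
`ℂ` this is `Γ_𝒢`; for values in `A` it is `id ⊗ Γ_𝒢 : A ⊗ C(𝒢) → A ⊗ C(𝒢) ⊗ C(𝒢)`. -/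
def coproduct {B : Type*} [Zero B] (F : Mor V → B) (x y : Mor V) : B :=
  if h : x.s = y.r then F (x.comp y h) else 0

variable {V} in
/-- The antipode `κ(f)(x) = f(x⁻¹)` of `C(𝒢)`. -/
def antipode (f : Mor V → ℂ) : Mor V → ℂ := fun x => f x.inv

/-- `C(𝒢)` as an algebra of multiplication operators on `l²(𝒢)`. -/
def CG : Set (Op (l2 (Mor V))) := Set.range mulOp

variable {V} in
/-- The right regular operators: `(ρ(x)ξ)(t) = ξ(tx)` if `s(t) = r(x)`, and `0` otherwise. -/
def rho (x : Mor V) : Op (l2 (Mor V)) :=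
  opOf
    { toFun := fun ξ t => if h : t.s = x.r then ξ (t.comp x h) else 0
      map_add' := fun ξ η => by
        ext t; by_cases h : t.s = x.r <;> simp [h]
      map_smul' := fun c ξ => by
        ext t; by_cases h : t.s = x.r <;> simp [h] }

/-- The right regular algebra `ℛ(𝒢) = {∑ aₓ ρ(x)}`. -/
def RG : Set (Op (l2 (Mor V))) := Submodule.span ℂ (Set.range (rho (V := V)))

variable {V} in
/-- The function `n ∘ r` on `𝒢`, as a multiplication operator. -/
def rOp (n : V → ℂ) : Op (l2 (Mor V)) := mulOp fun x => n x.r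

variable {V} in
/-- The function `n ∘ s` on `𝒢`, as a multiplication operator. -/
def sOp (n : V → ℂ) : Op (l2 (Mor V)) := mulOp fun x => n x.s

/-- The Weyl algebra: the commutant of `r(l^∞(𝒢⁰))` in `ℒ(l²(𝒢))`. -/
def Weyl : StarSubalgebra ℂ (Op (l2 (Mor V))) :=
  StarSubalgebra.centralizer ℂ (Set.range (rOp (V := V)))

/-! #### The multiplicative partial isometries `I` and `Ĩ` -/

/-- `(Iξ)(x, y) = ξ(xy, y)` if `s(x) = r(y)`, and `0` otherwise. -/
def mpi : Op (l2 (Mor V × Mor V)) :=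
  opOf
    { toFun := fun ξ p =>
        if h : p.1.s = p.2.r then ξ (p.1.comp p.2 h, p.2) else 0
      map_add' := fun ξ η => by
        ext p; by_cases h : p.1.s = p.2.r <;> simp [h]
      map_smul' := fun c ξ => by
        ext p; by_cases h : p.1.s = p.2.r <;> simp [h] }

/-- The flip `Σ`. -/
def flip : Op (l2 (Mor V × Mor V)) :=
  opOf
    { toFun := fun ξ p => ξ (p.2, p.1)
      map_add' := fun ξ η => by ext p; simp
      map_smul' := fun c ξ => by ext p; simp }

/-- `1 ⊗ U`, where `U = JĴ` is the unitary `(Uξ)(x) = ξ(x⁻¹)` of `l²(𝒢)`: here `J` is complex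
conjugation and `(Ĵξ)(x)` is the conjugate of `ξ(x⁻¹)`. -/
def oneTensU : Op (l2 (Mor V × Mor V)) :=
  opOf
    { toFun := fun ξ p => ξ (p.1, p.2.inv)
      map_add' := fun ξ η => by ext p; simp
      map_smul' := fun c ξ => by ext p; simp }

/-- `Ĩ = Σ (1 ⊗ U) I (1 ⊗ U) Σ`. -/
def mpiTilde : Op (l2 (Mor V × Mor V)) :=
  flip V * oneTensU V * mpi V * oneTensU V * flip V

/-- Explicitly, `(Ĩξ)(x, y) = ξ(x, y x⁻¹)` if `s(x) = s(y)`, and `0` otherwise. -/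
theorem mpiTilde_apply (ξ : l2 (Mor V × Mor V)) (x y : Mor V) :
    mpiTilde V ξ (x, y) = if h : y.s = x.s then ξ (x, y.comp x.inv h) else 0 := by
  have h0 : x.inv.inv = x := by simp [Mor.inv]
  simp only [mpiTilde, flip, oneTensU, mpi, mul_apply_eq_comp, opOf_apply,
    LinearMap.coe_mk, AddHom.coe_mk, h0]
  rfl

/-! #### Actions and crossed products -/

variable {V}

/-- The projection `e_{c,d} = ∑_u c(δ_u) ⊗ d(δ_u)` attached to two representations of the base
`C(𝒢⁰)`. -/
def eProj {K : Type*} [NormedAddCommGroup K] [InnerProductSpace ℂ K]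
    (c : (V → ℂ) → Op K) (d : (V → ℂ) → Op (l2 (Mor V))) : Op (Amp K (Mor V)) :=
  letI := Fintype.ofFinite V
  ∑ u : V, tens (c (dirac u)) (d (dirac u))

section Action

variable {H : Type*} [NormedAddCommGroup H] [InnerProductSpace ℂ H] [CompleteSpace H]

/-- The projection `e_{b,i}`, where `i` is the inclusion of `S_t = {n ∘ r}` in `C(𝒢)`, and where
`b` is given on `S_t ≅ C(𝒢⁰)`. -/
def eB {A : VonNeumannAlgebra H} (b : (V → ℂ) →⋆ₐ[ℂ] A.toStarSubalgebra) :
    Op (Amp H (Mor V)) :=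
  eProj (fun n => ((b n : A.toStarSubalgebra) : Op H)) rOp

/-- A right action of `(C(𝒢), Γ_𝒢, κ_𝒢)` on the von Neumann module `(A, b)`; the algebra
`A ⊗ C(𝒢)` is `C(𝒢, A)`. -/
structure RightAction (A : VonNeumannAlgebra H) (b : (V → ℂ) →⋆ₐ[ℂ] A.toStarSubalgebra) where
  /-- The (not necessarily unital) `*`-homomorphism `δ : A → A ⊗ C(𝒢)`. -/
  δ : A.toStarSubalgebra →⋆ₙₐ[ℂ] (Mor V → A.toStarSubalgebra)
  injective : Function.Injective δ
  normal : IsNormalMap A fun a => funOp fun g => (δ a g : Op H)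
  /-- `(δ ⊗ id) δ = (id ⊗ Γ) δ`. -/
  coassoc : ∀ (a : A.toStarSubalgebra) (x y : Mor V), δ (δ a y) x = coproduct (δ a) x y
  /-- `δ(b(n)) = e_{b,i} (1 ⊗ κ(n))` for `n` in `S_t`. -/
  base : ∀ n : V → ℂ, (funOp fun g => (δ (b n) g : Op H)) =
    eB b * tens 1 (mulOp (antipode fun x => n x.r))

namespace RightAction

variable {A : VonNeumannAlgebra H} {b : (V → ℂ) →⋆ₐ[ℂ] A.toStarSubalgebra} (α : RightAction A b)

/-- `δ(a)` as an operator on `H ⊗ l²(𝒢)`. -/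
def op (a : A.toStarSubalgebra) : Op (Amp H (Mor V)) := funOp fun g => (α.δ a g : Op H)

/-- The crossed product `A ⋊_δ C(𝒢)`: the von Neumann algebra generated by `δ(A)` and
`e_{b,i} (1 ⊗ ℛ(𝒢))`. -/
def crossedProduct : NonUnitalStarSubalgebra ℂ (Op (Amp H (Mor V))) :=
  vNGen (Set.range α.op ∪ {X | ∃ T ∈ RG V, X = eB b * tens 1 T})

/-- The dual coaction `δ̂(X) = Ĩ₂₃ (X ⊗ 1) Ĩ₂₃*`. -/
def dualCoaction (X : Op (Amp H (Mor V))) : Op (Amp (Amp H (Mor V)) (Mor V)) :=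
  leg23 (mpiTilde V) * tens X 1 * star (leg23 (mpiTilde V))

/-- `b̂ (n ∘ s) = e_{b,i} (1 ⊗ β̂(n))`, where `β̂(n) = n ∘ s`. -/
def bHat (b : (V → ℂ) →⋆ₐ[ℂ] A.toStarSubalgebra) (n : V → ℂ) : Op (Amp H (Mor V)) :=
  eB b * tens 1 (sOp n)

/-- The projection `e_{b̂,î}`, where `î` is the inclusion of `{n ∘ s}` in `ℛ(𝒢)`. -/
def eBHat (b : (V → ℂ) →⋆ₐ[ℂ] A.toStarSubalgebra) : Op (Amp (Amp H (Mor V)) (Mor V)) :=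
  eProj (bHat b) sOp

/-- The double crossed product `(A ⋊_δ C(𝒢)) ⋊̂_δ̂ ℛ(𝒢)`: the von Neumann algebra generated by
`δ̂(A ⋊_δ C(𝒢))` and `e_{b̂,î} (1 ⊗ S')`, where `S'` is the commutant of `S = C(𝒢)`. -/
def doubleCrossedProduct : NonUnitalStarSubalgebra ℂ (Op (Amp (Amp H (Mor V)) (Mor V))) :=
  vNGen (dualCoaction '' α.crossedProduct ∪
    {X | ∃ T ∈ Set.centralizer (CG V), X = eBHat b * tens 1 T})

theorem isStarProjection_op_one : IsStarProjection (α.op 1) := by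
  constructor
  · unfold IsIdempotentElem op
    rw [← funOp_mul]
    congr 1
    funext g
    have := congrFun (map_mul α.δ 1 1) g
    rw [mul_one] at this
    simpa using (congrArg (fun z : A.toStarSubalgebra => (z : Op H)) this).symm
  · unfold IsSelfAdjoint op
    rw [← funOp_star]
    congr 1
    funext g
    have := congrFun (map_star α.δ 1) g
    rw [star_one] at this
    simpa using (congrArg (fun z : A.toStarSubalgebra => (z : Op H)) this).symm

theorem op_one_mem : α.op 1 ∈ vNTensor (A : Set (Op H)) (Weyl V : Set (Op (l2 (Mor V)))) := by
  refine sum_mem fun g _ => subset_vNGen _ ⟨_, (α.δ 1 g).2, _, ?_, rfl⟩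
  have hc : ∀ f f' : Mor V → ℂ, mulOp f * mulOp f' = mulOp f' * mulOp f := by
    intro f f'
    ext ξ t
    simp [mul_left_comm]
  have hs : ∀ f : Mor V → ℂ, star (mulOp f) = mulOp (star f) := by
    intro f
    symm
    rw [ContinuousLinearMap.star_eq_adjoint, ContinuousLinearMap.eq_adjoint_iff]
    intro ξ η
    simp [PiLp.inner_apply]
    exact Finset.sum_congr rfl fun _ _ => by ring
  simp only [Weyl, SetLike.mem_coe, StarSubalgebra.mem_centralizer_iff]
  rintro _ ⟨n, rfl⟩
  exact ⟨hc _ _, by rw [rOp, hs]; exact hc _ _⟩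

/-- The reduced algebra `δ(1) (A ⊗ 𝒲(𝒢)) δ(1)`. -/
def weylCorner : NonUnitalStarSubalgebra ℂ (Op (Amp H (Mor V))) :=
  corner (vNTensor (A : Set (Op H)) (Weyl V : Set (Op (l2 (Mor V))))) (α.op 1)
    α.isStarProjection_op_one α.op_one_mem

end RightAction

end Action

end Groupoid

end QGpd

end

/-!
Write `p_u = b(δ_u)` and `δ_g(a) = δ(a)(g)`. Coassociativity reads `δ_x δ_y = δ_{xy}` when `x y` is
defined and `δ_x δ_y = 0` otherwise, and the condition on the base gives `δ_g(1) = p_{r(g)}`. As `δ` is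
injective, the maps `δ_u` of the units `u` separate the points of `A`; it follows that
`δ_u(a) = p_u a = a p_u`, so that `A` is the direct sum of its ideals `p_u A`, between which `𝒢` acts by
isomorphisms.

Everything is read off operator matrices over `𝒢`. The reduced algebra `δ(1)(A ⊗ 𝒲(𝒢))δ(1)` consists
of the matrices `m` over `A` with `m(y, y') ∈ p_{r(y)} A ∩ p_{r(y')} A` (`coefficients`,
`range_blockHom`). The double crossed product acts on families indexed by pairs `(x, y)` with
`s(x) = s(y)`, and its generators preserve the fibre over each `w = x y⁻¹`; on that fibre, indexed by
`y`, they act by matrices `δ_w(m(y, y'))` with `m` independent of `w`. The map `m ↦ ⊕_w δ_w(m)`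
(`inflateHom`) is thus an injective `*`-homomorphism, `m` being recovered from the fibres over the
units, and its range contains the generators. Conversely a matrix with a single entry is a product of
three generators, from `C(𝒢)`, `A` and `ℛ(𝒢)` (`inflateHom_single_mem`). So the range is the algebra
generated by the generators, and it remains to see that it is weakly closed.

This is where normality enters, since the `δ_w` need not be weakly continuous: what is true, and
enough, is that their graphs are weakly closed (`isWOTClosed_graph`). For a normal representation `φ`
of `A`, call `η` dominated if `‖φ(x)η‖ ≤ ‖xξ‖` for some `ξ` and all `x ∈ A`. The functionals
`x ↦ f(φ(x)η)` are then weakly continuous on `A`, so the equations `f(Tη) = f(φ(a)η)` for dominated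
`η` define a weakly closed set of pairs `(a, T)`. A comparison of normal functionals by Zorn's lemma
(`exists_map_mem_dominated`) shows that the dominated vectors are total, so these equations say
`T = φ(a)`.

The statements on the Weyl algebra hold because it is spanned by the matrix units `δ_t ρ(t⁻¹ t')`
with `r(t) = r(t')`.
-/

noncomputable section

namespace QGpd

open scoped Classical ComplexInnerProductSpace
open CategoryTheory Filter Topology

/-! ### Directed families of positive operators -/

section Order

open scoped ComplexOrder

theorem op_le_iff {K : Type*} [NormedAddCommGroup K] [InnerProductSpace ℂ K] {S T : Op K} :
    S ≤ T ↔ ∀ ξ, 0 ≤ ⟪(T - S) ξ, ξ⟫ := by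
  rw [ContinuousLinearMap.le_def, ContinuousLinearMap.isPositive_iff_complex]
  refine forall_congr' fun ξ => ?_
  rw [Complex.nonneg_iff]
  constructor
  · rintro ⟨h1, h2⟩
    refine ⟨h2, ?_⟩
    rw [← h1]; simp
  · rintro ⟨h1, h2⟩
    refine ⟨?_, h1⟩
    exact Complex.ext (by simp) (by rw [← h2]; simp)

variable {K : Type*} [NormedAddCommGroup K] [InnerProductSpace ℂ K] [CompleteSpace K]

/-- Bounded upward directed families of positive operators converge weakly to their least upper
bound, which lies in the double commutant of the family. The limit is taken along an ultrafilter
finer than the order filter, which spares the proof of convergence. -/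
theorem exists_isLUB_of_directed {D : Set (Op K)} (hne : D.Nonempty) (hpos : ∀ x ∈ D, 0 ≤ x)
    (hdir : DirectedOn (· ≤ ·) D) (hbdd : BddAbove D) :
    ∃ T : Op K, IsLUB D T ∧
      (∀ ξ, IsLUB ((fun x : Op K => x.reApplyInnerSelf ξ) '' D) (T.reApplyInnerSelf ξ)) ∧
      ∀ S : Op K, (∀ x ∈ D, S * x = x * S) → S * T = T * S := by
  obtain ⟨B, hB⟩ := hbdd
  have : Nonempty D := hne.to_subtype
  have : IsDirected D (· ≤ ·) := ⟨fun a b => by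
    obtain ⟨c, hc, h1, h2⟩ := hdir a a.2 b b.2
    exact ⟨⟨c, hc⟩, h1, h2⟩⟩
  let U : Ultrafilter D := Ultrafilter.of atTop
  have hU : ∀ d : D, ∀ᶠ e in (U : Filter D), d ≤ e := fun d =>
    (Ultrafilter.of_le atTop) (eventually_ge_atTop d)
  have hnorm : ∀ d : D, ‖(d : Op K)‖ ≤ ‖B‖ := fun d =>
    CStarAlgebra.norm_le_norm_of_nonneg_of_le (hpos d d.2) (hB d.2)
  have hbound : ∀ (ξ η : K) (d : D), ‖⟪(d : Op K) ξ, η⟫‖ ≤ ‖B‖ * ‖ξ‖ * ‖η‖ := fun ξ η d =>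
    (norm_inner_le_norm _ _).trans (by
      gcongr
      exact ((d : Op K).le_opNorm ξ).trans (by gcongr; exact hnorm d))
  have hlim : ∀ ξ η : K, ∃ z ∈ Metric.closedBall (0 : ℂ) (‖B‖ * ‖ξ‖ * ‖η‖),
      Tendsto (fun d : D => ⟪(d : Op K) ξ, η⟫) U (𝓝 z) := fun ξ η => by
    obtain ⟨z, hz, h⟩ := (isCompact_closedBall (0 : ℂ) (‖B‖ * ‖ξ‖ * ‖η‖)).ultrafilter_le_nhds
      (U.map fun d : D => ⟪(d : Op K) ξ, η⟫) (by
        rw [Filter.le_principal_iff]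
        refine Filter.mem_map.2 (Filter.univ_mem' fun d => ?_)
        simpa using hbound ξ η d)
    exact ⟨z, hz, h⟩
  choose L hLb hL using hlim
  let L2 : K →ₗ⋆[ℂ] K →ₗ[ℂ] ℂ := LinearMap.mk₂'ₛₗ (starRingEnd ℂ) (RingHom.id ℂ) L
    (fun a b c => tendsto_nhds_unique (hL _ _) (by
      simpa [inner_add_left] using (hL a c).add (hL b c)))
    (fun r a c => tendsto_nhds_unique (hL _ _) (by
      simpa [inner_smul_left, mul_comm] using (hL a c).const_mul (starRingEnd ℂ r)))
    (fun a b c => tendsto_nhds_unique (hL _ _) (by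
      simpa [inner_add_right] using (hL a b).add (hL a c)))
    (fun r a c => tendsto_nhds_unique (hL _ _) (by
      simpa [inner_smul_right] using (hL a c).const_mul r))
  let L3 : K →L⋆[ℂ] K →L[ℂ] ℂ := L2.mkContinuous₂ ‖B‖ (fun ξ η => by simpa using! hLb ξ η)
  let T : Op K := InnerProductSpace.continuousLinearMapOfBilin L3
  have hT : ∀ ξ η, Tendsto (fun d : D => ⟪(d : Op K) ξ, η⟫) U (𝓝 ⟪T ξ, η⟫) := fun ξ η => by
    have : ⟪T ξ, η⟫ = L ξ η := InnerProductSpace.continuousLinearMapOfBilin_apply L3 ξ η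
    rw [this]; exact hL ξ η
  have hub : T ∈ upperBounds D := fun d hd => by
    rw [op_le_iff]
    intro ξ
    refine ge_of_tendsto (x := U) (f := fun e : D => ⟪((e : Op K) - d) ξ, ξ⟫) ?_ ?_
    · simpa [inner_sub_left] using (hT ξ ξ).sub_const _
    · filter_upwards [hU ⟨d, hd⟩] with e he
      exact op_le_iff.1 he ξ
  refine ⟨T, ⟨hub, fun C hC => ?_⟩, fun ξ => ⟨?_, ?_⟩, fun S hS => ?_⟩
  · rw [op_le_iff]
    intro ξ
    refine ge_of_tendsto' (x := U) (f := fun e : D => ⟪(C - (e : Op K)) ξ, ξ⟫) ?_ ?_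
    · simpa [inner_sub_left] using (hT ξ ξ).const_sub _
    · exact fun e => op_le_iff.1 (hC e.2) ξ
  · rintro _ ⟨d, hd, rfl⟩
    have := (Complex.nonneg_iff.1 (op_le_iff.1 (hub hd) ξ)).1
    simpa [ContinuousLinearMap.reApplyInnerSelf, inner_sub_left] using this
  · intro c hc
    refine le_of_tendsto' (x := (U : Filter D))
      ((Complex.continuous_re.tendsto _).comp (hT ξ ξ)) fun d => ?_
    exact hc ⟨d, d.2, rfl⟩
  · ext ξ
    refine ext_inner_right ℂ fun η => ?_
    have h1 := hT (S ξ) η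
    have h2 := hT ξ (ContinuousLinearMap.adjoint S η)
    simp only [ContinuousLinearMap.adjoint_inner_right] at h2
    refine tendsto_nhds_unique h2 (h1.congr fun d => ?_)
    exact congrArg (fun z => ⟪z, η⟫) (DFunLike.congr_fun (hS d d.2) ξ).symm

theorem isLUB_reApplyInnerSelf {D : Set (Op K)} {a : Op K} (hne : D.Nonempty)
    (hpos : ∀ x ∈ D, 0 ≤ x) (hdir : DirectedOn (· ≤ ·) D) (ha : IsLUB D a) (ξ : K) :
    IsLUB ((fun x : Op K => x.reApplyInnerSelf ξ) '' D) (a.reApplyInnerSelf ξ) := by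
  obtain ⟨T, hT, h, -⟩ := exists_isLUB_of_directed hne hpos hdir ha.bddAbove
  rw [ha.unique hT]
  exact h ξ

/-- Membership in `A` by the double commutant property. -/
theorem mem_of_commute_commutant {H : Type*} [NormedAddCommGroup H]
    [InnerProductSpace ℂ H] [CompleteSpace H] (A : VonNeumannAlgebra H) {T : Op H}
    (h : ∀ S : Op H, (∀ x ∈ A, S * x = x * S) → S * T = T * S) : T ∈ A := by
  rw [← SetLike.mem_coe, ← A.centralizer_centralizer]
  intro S hS
  exact h S fun x hx => (hS x hx).symm

end Order

/-! ### Normal representations and dominated vectors -/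

section NormalRep

open scoped ComplexOrder

variable {H K : Type*} [NormedAddCommGroup H] [InnerProductSpace ℂ H] [CompleteSpace H]
  [NormedAddCommGroup K] [InnerProductSpace ℂ K] [CompleteSpace K]

theorem exists_star_mul_self_of_nonneg (A : VonNeumannAlgebra H) (a : A.toStarSubalgebra)
    (ha : (0 : Op H) ≤ a) : ∃ y : A.toStarSubalgebra, a = star y * y := by
  have hs : IsSelfAdjoint (CFC.sqrt (a : Op H)) := (CFC.sqrt_nonneg _).isSelfAdjoint
  have hm : CFC.sqrt (a : Op H) ∈ A := by
    refine mem_of_commute_commutant A fun S hS => ?_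
    have h : Commute (a : Op H) S := (hS a a.2).symm
    rw [CFC.sqrt_eq_cfc]
    exact (h.cfc_nnreal _).symm.eq
  refine ⟨⟨_, hm⟩, Subtype.ext ?_⟩
  change (a : Op H) = star (CFC.sqrt (a : Op H)) * CFC.sqrt (a : Op H)
  rw [hs.star_eq, CFC.sqrt_mul_sqrt_self _ ha]

theorem reApplyInnerSelf_mono {K : Type*} [NormedAddCommGroup K] [InnerProductSpace ℂ K] {S T : Op K} (h : S ≤ T) (ξ : K) :
    S.reApplyInnerSelf ξ ≤ T.reApplyInnerSelf ξ := by
  have := (Complex.nonneg_iff.1 (op_le_iff.1 h ξ)).1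
  simpa [ContinuousLinearMap.reApplyInnerSelf, inner_sub_left] using this

theorem reApplyInnerSelf_star_mul_self (T : Op K) (ξ : K) :
    (star T * T).reApplyInnerSelf ξ = ‖T ξ‖ ^ 2 := by
  simp [ContinuousLinearMap.reApplyInnerSelf, ContinuousLinearMap.star_eq_adjoint,
    ContinuousLinearMap.adjoint_inner_left]
  rw [← Complex.ofReal_pow]
  exact Complex.ofReal_re _

/-- Zorn's lemma for the operators of `A` between `0` and `s` on which a functional `μ` that
preserves directed suprema is dominated by a monotone functional `ν`. -/
theorem exists_maximal_dominated (A : VonNeumannAlgebra H) (s : Op H)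
    (μ ν : A.toStarSubalgebra → ℝ)
    (hν : ∀ x y : A.toStarSubalgebra, (x : Op H) ≤ y → ν x ≤ ν y)
    (hμ : ∀ (D : Set A.toStarSubalgebra) (a : A.toStarSubalgebra), D.Nonempty →
      (∀ x ∈ D, (0 : Op H) ≤ (x : Op H)) →
      DirectedOn (fun x y : A.toStarSubalgebra => (x : Op H) ≤ (y : Op H)) D →
      IsLUB ((fun x : A.toStarSubalgebra => (x : Op H)) '' D) (a : Op H) → IsLUB (μ '' D) (μ a))
    (hs : 0 ≤ s) (h0 : μ 0 ≤ ν 0) :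
    ∃ h : A.toStarSubalgebra, (0 : Op H) ≤ h ∧ (h : Op H) ≤ s ∧ μ h ≤ ν h ∧
      ∀ e : A.toStarSubalgebra, (0 : Op H) ≤ e → (h : Op H) + e ≤ s → μ (h + e) ≤ ν (h + e) →
        e = 0 := by
  obtain ⟨m, -, hm⟩ := zorn_le_nonempty₀
    {T : Op H | ∃ h : A.toStarSubalgebra, (h : Op H) = T ∧ 0 ≤ T ∧ T ≤ s ∧ μ h ≤ ν h}
    (by
      intro C hC hchain y hy
      obtain ⟨T, hT, -, hcomm⟩ := exists_isLUB_of_directed ⟨y, hy⟩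
        (fun x hx => (hC hx).choose_spec.2.1)
        hchain.directedOn ⟨s, fun x hx => (hC hx).choose_spec.2.2.1⟩
      have hTA : T ∈ A := mem_of_commute_commutant A fun S hS => hcomm S fun x hx => by
        obtain ⟨h, rfl, -⟩ := hC hx
        exact hS _ h.2
      refine ⟨T, ⟨⟨T, hTA⟩, rfl, (hC hy).choose_spec.2.1.trans (hT.1 hy),
        hT.2 fun x hx => (hC hx).choose_spec.2.2.1, ?_⟩, hT.1⟩
      let D : Set A.toStarSubalgebra := {h | (h : Op H) ∈ C}
      have hD : (fun x : A.toStarSubalgebra => (x : Op H)) '' D = C := by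
        ext x
        constructor
        · rintro ⟨h, hh, rfl⟩; exact hh
        · intro hx
          obtain ⟨h, rfl, -⟩ := hC hx
          exact ⟨h, hx, rfl⟩
      have hle : ∀ h ∈ D, μ h ≤ ν h := fun h hh => by
        obtain ⟨h', h1, -, -, h2⟩ := hC hh
        rwa [Subtype.ext h1] at h2
      refine (hμ D ⟨T, hTA⟩ ?_ ?_ ?_ (by rw [hD]; exact hT)).2 ?_
      · obtain ⟨h, rfl, -⟩ := hC hy
        exact ⟨h, hy⟩
      · exact fun x hx => (hC hx).choose_spec.2.1
      · intro x hx z hz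
        obtain ⟨w, hw, h1, h2⟩ := hchain.directedOn _ hx _ hz
        obtain ⟨h, rfl, -⟩ := hC hw
        exact ⟨h, hw, h1, h2⟩
      · rintro _ ⟨h, hh, rfl⟩
        exact (hle h hh).trans (hν _ _ (hT.1 hh)))
    0 ⟨0, rfl, le_rfl, hs, h0⟩
  obtain ⟨⟨h, rfl, h1, h2, h3⟩, hmax⟩ := hm
  refine ⟨h, h1, h2, h3, fun e he hes hle => ?_⟩
  have : (h : Op H) + e ≤ h := hmax ⟨h + e, rfl, add_nonneg h1 he, hes, hle⟩
    (le_add_of_nonneg_right he)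
  have : (e : Op H) ≤ 0 := by simpa using this
  exact Subtype.ext (le_antisymm this he)

/-- The vectors on which a representation `φ` of `A` is dominated by a vector of the space of `A`.
The coefficients of `φ` at such vectors are weakly continuous. -/
def dominated (A : VonNeumannAlgebra H) (φ : A.toStarSubalgebra →⋆ₙₐ[ℂ] Op K) : Set K :=
  {η | ∃ ξ : H, ∀ x : A.toStarSubalgebra, ‖φ x η‖ ≤ ‖(x : Op H) ξ‖}

variable {A : VonNeumannAlgebra H} {φ : A.toStarSubalgebra →⋆ₙₐ[ℂ] Op K}

theorem map_nonneg_of_nonneg {a : A.toStarSubalgebra} (ha : (0 : Op H) ≤ a) : 0 ≤ φ a := by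
  obtain ⟨y, rfl⟩ := exists_star_mul_self_of_nonneg A a ha
  rw [map_mul, map_star]
  exact star_mul_self_nonneg _

theorem map_le_map {a a' : A.toStarSubalgebra} (ha : (a : Op H) ≤ a') : φ a ≤ φ a' := by
  rw [← sub_nonneg, ← map_sub]
  exact map_nonneg_of_nonneg (by simpa using ha)

/-- Comparison of the normal functional `ω = ⟨φ(·)η, η⟩` with a vector functional `ω_ξ`. Let `1 - s`
be a maximal positive contraction killed by `ω`, let `ω(s) < ω_ξ(s)`, and let `h ≤ s` be maximal with
`ω_ξ(h) ≤ ω(h)`. Then `c = s - h` satisfies `ω ≤ ω_ξ` below `c`, so `φ(c)η` is dominated by `c ξ`, and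
`ω(c) ≠ 0` by the choice of `s`. -/
theorem exists_map_mem_dominated (hφ : IsNormalMap A φ) (η : K) (hη : φ 1 η ≠ 0) :
    ∃ c : A.toStarSubalgebra, φ c η ∈ dominated A φ ∧ ⟪φ c η, η⟫ ≠ 0 := by
  let ω : A.toStarSubalgebra → ℝ := fun a => (φ a).reApplyInnerSelf η
  let vec : H → A.toStarSubalgebra → ℝ := fun ξ a => (a : Op H).reApplyInnerSelf ξ
  have hω_add : ∀ a a', ω (a + a') = ω a + ω a' := fun a a' => by
    simp [ω, ContinuousLinearMap.reApplyInnerSelf, inner_add_left]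
  have hv_add : ∀ ξ a a', vec ξ (a + a') = vec ξ a + vec ξ a' := fun ξ a a' => by
    simp [vec, ContinuousLinearMap.reApplyInnerSelf, inner_add_left]
  have hω0 : ω 0 = 0 := by simp [ω, ContinuousLinearMap.reApplyInnerSelf]
  have hv0 : ∀ ξ, vec ξ 0 = 0 := by simp [vec, ContinuousLinearMap.reApplyInnerSelf]
  have hω_mono : ∀ x y : A.toStarSubalgebra, (x : Op H) ≤ y → ω x ≤ ω y := fun x y h =>
    reApplyInnerSelf_mono (map_le_map h) η
  have hω_norm : ∀ (D : Set A.toStarSubalgebra) (a : A.toStarSubalgebra), D.Nonempty →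
      (∀ x ∈ D, (0 : Op H) ≤ (x : Op H)) →
      DirectedOn (fun x y : A.toStarSubalgebra => (x : Op H) ≤ (y : Op H)) D →
      IsLUB ((fun x : A.toStarSubalgebra => (x : Op H)) '' D) (a : Op H) →
      IsLUB (ω '' D) (ω a) := fun D a hne hpos hdir hlub => by
    have := isLUB_reApplyInnerSelf (D := φ '' D) (hne.image _)
      (by rintro _ ⟨x, hx, rfl⟩; exact map_nonneg_of_nonneg (hpos x hx))
      (by
        rintro _ ⟨x, hx, rfl⟩ _ ⟨y, hy, rfl⟩
        obtain ⟨z, hz, h1, h2⟩ := hdir x hx y hy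
        exact ⟨_, ⟨z, hz, rfl⟩, map_le_map h1, map_le_map h2⟩)
      (hφ D a hne hpos hdir hlub) η
    rwa [Set.image_image] at this
  have hv_norm : ∀ ξ (D : Set A.toStarSubalgebra) (a : A.toStarSubalgebra), D.Nonempty →
      (∀ x ∈ D, (0 : Op H) ≤ (x : Op H)) →
      DirectedOn (fun x y : A.toStarSubalgebra => (x : Op H) ≤ (y : Op H)) D →
      IsLUB ((fun x : A.toStarSubalgebra => (x : Op H)) '' D) (a : Op H) →
      IsLUB (vec ξ '' D) (vec ξ a) := fun ξ D a hne hpos hdir hlub => by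
    have := isLUB_reApplyInnerSelf (hne.image fun x : A.toStarSubalgebra => (x : Op H))
      (by rintro _ ⟨x, hx, rfl⟩; exact hpos x hx)
      (by
        rintro _ ⟨x, hx, rfl⟩ _ ⟨y, hy, rfl⟩
        obtain ⟨z, hz, h1, h2⟩ := hdir x hx y hy
        exact ⟨_, ⟨z, hz, rfl⟩, h1, h2⟩)
      hlub ξ
    rwa [Set.image_image] at this
  have hω_pos : ∀ x : A.toStarSubalgebra, (0 : Op H) ≤ x → 0 ≤ ω x := fun x hx => by
    simpa [hω0] using hω_mono 0 x hx
  have hω1 : 0 < ω 1 := by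
    have h1 : φ 1 = star (φ 1) * φ 1 := by rw [← map_star, ← map_mul]; simp
    have h2 : ω 1 = ‖φ 1 η‖ ^ 2 := by
      rw [← reApplyInnerSelf_star_mul_self, ← h1]
    rw [h2]
    exact pow_pos (norm_pos_iff.2 hη) 2
  obtain ⟨k, hk0, hk1, hkω, hkmax⟩ := exists_maximal_dominated A 1 ω (fun _ => 0)
    (fun _ _ _ => le_rfl) hω_norm zero_le_one hω0.le
  let s : A.toStarSubalgebra := 1 - k
  have hs0 : (0 : Op H) ≤ s := by simpa [s] using hk1
  have hs1 : (s : Op H) ≤ 1 := by simpa [s] using hk0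
  obtain ⟨ξ, hξ⟩ : ∃ ξ, ω s < vec ξ s := by
    have hsne : (s : Op H) ≠ 0 := fun h => by
      have : k = 1 := (sub_eq_zero.1 (Subtype.ext h : s = 0)).symm
      rw [this] at hkω
      exact absurd hkω (not_le.2 hω1)
    obtain ⟨y, hy⟩ := exists_star_mul_self_of_nonneg A s hs0
    have hv : ∀ ξ, vec ξ s = ‖(y : Op H) ξ‖ ^ 2 := fun ξ => by
      rw [← reApplyInnerSelf_star_mul_self]
      change (s : Op H).reApplyInnerSelf ξ = _
      rw [hy]; rfl
    obtain ⟨ξ, hξ⟩ : ∃ ξ, (y : Op H) ξ ≠ 0 := by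
      by_contra! h
      have : (y : Op H) = 0 := by ext ξ; simpa using h ξ
      have hy0 : y = 0 := Subtype.ext this
      exact hsne (by rw [hy, hy0]; simp)
    have hpos : 0 < ‖(y : Op H) ξ‖ := norm_pos_iff.2 hξ
    -- `ω_ξ(s) > 0`, so a large multiple of `ξ` serves.
    obtain ⟨n, hn⟩ := exists_nat_gt ((ω s + 1) / ‖(y : Op H) ξ‖)
    have hn' : ω s + 1 < n * ‖(y : Op H) ξ‖ := (div_lt_iff₀ hpos).1 hn
    have hs : 0 ≤ ω s := hω_pos s hs0
    refine ⟨(n : ℂ) • ξ, ?_⟩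
    rw [hv, map_smul, norm_smul, Complex.norm_natCast]
    nlinarith
  obtain ⟨h, hh0, hhs, hhω, hhmax⟩ := exists_maximal_dominated A s (vec ξ) ω hω_mono (hv_norm ξ)
    hs0 (by rw [hω0, hv0])
  let c : A.toStarSubalgebra := s - h
  have hc0 : (0 : Op H) ≤ c := by simpa [c] using hhs
  have hc1 : (c : Op H) ≤ 1 := (show (c : Op H) ≤ s by simpa [c] using hh0).trans hs1
  have hcω : ω c ≠ 0 := fun hc => by
    -- Otherwise `k + c` is killed by `ω` as well, so `c = 0` and `ω_ξ(s) ≤ ω(s)`.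
    have : c = 0 := hkmax c hc0 (by
      have : (k : Op H) + c = 1 - h := by
        simp only [c, s, AddSubgroupClass.coe_sub, OneMemClass.coe_one]; abel
      rw [this]; simpa using hh0) (by rw [hω_add, hc, add_zero]; exact hkω)
    have : s = h := sub_eq_zero.1 this
    rw [← this] at hhω
    exact absurd hhω (not_le.2 hξ)
  have hcle : ∀ e : A.toStarSubalgebra, (0 : Op H) ≤ e → (e : Op H) ≤ c → ω e ≤ vec ξ e := by
    intro e he hec
    by_contra! hlt
    -- Otherwise `h + e` would exceed the maximal `h`.
    have he0 : e = 0 := hhmax e he (by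
      have := add_le_add_right hec (h : Op H)
      simpa [c] using this) (by rw [hω_add, hv_add]; exact add_le_add hhω hlt.le)
    rw [he0, hω0, hv0] at hlt
    exact lt_irrefl _ hlt
  have hcs : star c = c := Subtype.ext hc0.isSelfAdjoint.star_eq
  have key : ∀ x : A.toStarSubalgebra, ‖(x : Op H)‖ ≤ 1 →
      ‖φ x (φ c η)‖ ^ 2 ≤ ‖(x : Op H) ((c : Op H) ξ)‖ ^ 2 := by
    intro x hx
    have h1 := hcle (star (x * c) * (x * c)) (star_mul_self_nonneg ((x : Op H) * c)) (by
      have hxx : star (x : Op H) * x ≤ 1 := by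
        refine (CStarAlgebra.norm_le_one_iff_of_nonneg _ (star_mul_self_nonneg _)).1 ?_
        rw [CStarRing.norm_star_mul_self]
        exact mul_le_one₀ hx (norm_nonneg _) hx
      calc ((star (x * c) * (x * c) : A.toStarSubalgebra) : Op H)
          = star (c : Op H) * (star (x : Op H) * x) * c := by simp [mul_assoc]
        _ ≤ star (c : Op H) * 1 * c := star_left_conjugate_le_conjugate hxx _
        _ = (c : Op H) * (c : Op H) := by rw [hc0.isSelfAdjoint.star_eq, mul_one]
        _ ≤ c := by
          have hcomm : Commute (c : Op H) (1 - c) :=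
            (Commute.one_right _).sub_right (Commute.refl _)
          have := hcomm.mul_nonneg hc0 (sub_nonneg.2 hc1)
          rwa [mul_sub, mul_one, sub_nonneg] at this)
    have h2 : ω (star (x * c) * (x * c)) = ‖φ x (φ c η)‖ ^ 2 := by
      simp only [ω]
      rw [map_mul φ (star _), map_star, reApplyInnerSelf_star_mul_self, map_mul]; rfl
    have h3 : vec ξ (star (x * c) * (x * c)) = ‖(x : Op H) ((c : Op H) ξ)‖ ^ 2 :=
      reApplyInnerSelf_star_mul_self ((x : Op H) * (c : Op H)) ξ
    rwa [h2, h3] at h1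
  refine ⟨c, ⟨(c : Op H) ξ, fun x => ?_⟩, fun h => hcω ?_⟩
  · rcases eq_or_ne (x : Op H) 0 with hx | hx
    · have : x = 0 := Subtype.ext hx
      simp [this]
    · have hn : 0 < ‖(x : Op H)‖ := norm_pos_iff.2 hx
      have h1 := key ((‖(x : Op H)‖⁻¹ : ℂ) • x) (by
        simp [norm_smul, inv_mul_cancel₀ hn.ne'])
      have h2 := (sq_le_sq₀ (norm_nonneg _) (norm_nonneg _)).1 h1
      have h3 : ‖(x : Op H)‖⁻¹ * ‖φ x (φ c η)‖ ≤ ‖(x : Op H)‖⁻¹ * ‖(x : Op H) ((c : Op H) ξ)‖ := by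
        simpa [norm_smul] using h2
      exact le_of_mul_le_mul_left h3 (inv_pos.2 hn)
  · change (⟪φ c η, η⟫).re = 0
    rw [h]; rfl

/-- An operator that vanishes on the dominated vectors of a normal representation is zero. -/
theorem eq_zero_of_dominated (hφ : IsNormalMap A φ) {L : Type*} [NormedAddCommGroup L]
    [InnerProductSpace ℂ L] (T : K →L[ℂ] L) (hT : ∀ η ∈ dominated A φ, T η = 0) : T = 0 := by
  let E := (Submodule.span ℂ (dominated A φ)).topologicalClosure
  have hE : E ≤ LinearMap.ker (T : K →ₗ[ℂ] L) :=
    Submodule.topologicalClosure_minimal _ (Submodule.span_le.2 hT) T.isClosed_ker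
  have hsub : ∀ η ∈ dominated A φ, η ∈ E := fun η h =>
    Submodule.le_topologicalClosure _ (Submodule.subset_span h)
  have : CompleteSpace E := (Submodule.isClosed_topologicalClosure _).completeSpace_coe
  have htop : E = ⊤ := by
    rw [← Submodule.orthogonal_eq_bot_iff, Submodule.eq_bot_iff]
    intro η hη
    -- A vector killed by `φ(1)` is killed by `φ`, hence dominated by `0`.
    by_cases h1 : φ 1 η = 0
    · have hmem : η ∈ dominated A φ := ⟨0, fun x => by
        have : φ x η = φ x (φ 1 η) := by
          change _ = (φ x * φ 1) η
          rw [← map_mul, mul_one]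
        simp [this, h1]⟩
      exact inner_self_eq_zero.1 (hη η (hsub η hmem))
    · obtain ⟨c, hc, hne⟩ := exists_map_mem_dominated hφ η h1
      exact absurd (hη _ (hsub _ hc)) hne
  ext η
  exact hE (htop ▸ Submodule.mem_top)

/-- The functional `a ξ ↦ f(φ(a)η)` on `A ξ` is well defined and bounded by domination, and extends
to the whole space by the Hahn–Banach theorem. -/
theorem exists_functional_of_dominated {η : K} (hη : η ∈ dominated A φ) (f : StrongDual ℂ K) :
    ∃ (ξ : H) (g : StrongDual ℂ H), ∀ x : A.toStarSubalgebra, f (φ x η) = g ((x : Op H) ξ) := by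
  obtain ⟨ξ, hξ⟩ := hη
  let L : A.toStarSubalgebra →ₗ[ℂ] H :=
    { toFun := fun x => (x : Op H) ξ
      map_add' := fun x y => rfl
      map_smul' := fun c x => rfl }
  let M : A.toStarSubalgebra →ₗ[ℂ] ℂ :=
    { toFun := fun x => f (φ x η)
      map_add' := fun x y => by simp
      map_smul' := fun c x => by simp }
  have hML : ∀ x, ‖M x‖ ≤ ‖f‖ * ‖L x‖ := fun x =>
    (f.le_opNorm _).trans (by gcongr; exact hξ x)
  obtain ⟨σ, hσ⟩ := LinearMap.exists_rightInverse_of_surjective L.rangeRestrict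
    L.range_rangeRestrict
  have hσ' : ∀ y, L (σ y) = y := fun y => congrArg Subtype.val (LinearMap.congr_fun hσ y)
  let g₀ : StrongDual ℂ L.range := (M ∘ₗ σ).mkContinuous ‖f‖ fun y => by
    have := hML (σ y)
    rwa [hσ'] at this
  obtain ⟨g, hg, -⟩ := exists_extension_norm_eq L.range g₀
  refine ⟨ξ, g, fun x => ?_⟩
  have h1 : g (L x) = M (σ (L.rangeRestrict x)) := hg (L.rangeRestrict x)
  have h2 : M (x - σ (L.rangeRestrict x)) = 0 := by
    rw [← norm_le_zero_iff]
    refine (hML _).trans_eq ?_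
    rw [map_sub, hσ']; simp
  rw [map_sub, sub_eq_zero] at h2
  exact h2.trans h1.symm

end NormalRep

/-! ### The weak operator topology -/

section WOT

variable {K L : Type*} [NormedAddCommGroup K] [InnerProductSpace ℂ K]
  [NormedAddCommGroup L] [InnerProductSpace ℂ L]

/-- Continuity of a map between spaces of operators for the weak operator topologies. -/
def WOTContinuous (F : Op K → Op L) : Prop :=
  Continuous fun T : K →WOT[ℂ] K => ContinuousLinearMapWOT.ofCLM (F T.toCLM)

theorem IsWOTClosed.preimage {F : Op K → Op L} (hF : WOTContinuous F) {s : Set (Op L)}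
    (hs : IsWOTClosed s) : IsWOTClosed (F ⁻¹' s) :=
  IsClosed.preimage hF hs

theorem IsWOTClosed.iInter {ι : Sort*} {s : ι → Set (Op K)} (h : ∀ i, IsWOTClosed (s i)) :
    IsWOTClosed {T | ∀ i, T ∈ s i} := by
  have := isClosed_iInter h
  unfold IsWOTClosed
  convert this using 1
  ext; simp

theorem IsWOTClosed.inter {s t : Set (Op K)} (hs : IsWOTClosed s) (ht : IsWOTClosed t) :
    IsWOTClosed (s ∩ t) :=
  IsClosed.inter hs ht

theorem IsWOTClosed.setOf_imp {p : Prop} {s : Set (Op K)} (hs : p → IsWOTClosed s) :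
    IsWOTClosed {T | p → T ∈ s} := by
  by_cases hp : p
  · simpa [hp] using hs hp
  · simp [hp, IsWOTClosed]

theorem WOTContinuous.dual_apply {F : Op K → Op L} (hF : WOTContinuous F) (ξ : L)
    (f : StrongDual ℂ L) : Continuous fun T : K →WOT[ℂ] K => f (F T.toCLM ξ) :=
  (ContinuousLinearMapWOT.continuous_dual_apply ξ f).comp hF

theorem wotContinuous_comp (R : L →L[ℂ] K) (S : K →L[ℂ] L) :
    WOTContinuous fun T : Op K => S ∘L T ∘L R := by
  refine ContinuousLinearMapWOT.continuous_of_dual_apply_continuous fun ξ f => ?_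
  exact ContinuousLinearMapWOT.continuous_dual_apply (R ξ) (f ∘L S)

theorem WOTContinuous.comp {M : Type*} [NormedAddCommGroup M] [InnerProductSpace ℂ M]
    {F : Op K → Op L} {F' : Op L → Op M} (hF' : WOTContinuous F') (hF : WOTContinuous F) :
    WOTContinuous fun T => F' (F T) :=
  Continuous.comp (g := fun T : L →WOT[ℂ] L => ContinuousLinearMapWOT.ofCLM (F' T.toCLM)) hF' hF

theorem isWOTClosed_eq {F F' : Op K → Op L} (hF : WOTContinuous F) (hF' : WOTContinuous F') :
    IsWOTClosed {T | F T = F' T} := by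
  have := isClosed_eq hF hF'
  unfold IsWOTClosed
  convert this using 1
  ext T
  exact ContinuousLinearMapWOT.ofCLM_injective.eq_iff.symm

theorem wotContinuous_const (S : Op L) : WOTContinuous (fun _ : Op K => S) := continuous_const

theorem isWOTClosed_vonNeumannAlgebra [CompleteSpace K] (A : VonNeumannAlgebra K) :
    IsWOTClosed (A : Set (Op K)) := by
  rw [← A.centralizer_centralizer]
  refine IsWOTClosed.iInter fun S => IsWOTClosed.setOf_imp fun _ => ?_
  exact isWOTClosed_eq (wotContinuous_comp (ContinuousLinearMap.id ℂ K) S)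
    (wotContinuous_comp S (ContinuousLinearMap.id ℂ K))

theorem vNGen_le [CompleteSpace K] {T : Set (Op K)} {M : NonUnitalStarSubalgebra ℂ (Op K)}
    (hM : IsWOTClosed (M : Set (Op K))) (hT : T ⊆ M) : vNGen T ≤ M :=
  sInf_le ⟨hM, hT⟩

theorem vNGen_induction [CompleteSpace K] {T : Set (Op K)} {P : Op K → Prop}
    (closed : IsWOTClosed {X | P X}) (mem : ∀ X ∈ T, P X) (zero : P 0)
    (add : ∀ X Y, P X → P Y → P (X + Y)) (smul : ∀ (c : ℂ) X, P X → P (c • X))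
    (mul : ∀ X Y, P X → P Y → P (X * Y)) (star : ∀ X, P X → P (star X)) {X : Op K}
    (hX : X ∈ vNGen T) : P X :=
  let N : NonUnitalStarSubalgebra ℂ (Op K) :=
    { carrier := {X | P X}
      add_mem' := add _ _
      zero_mem' := zero
      smul_mem' := fun c _ => smul c _
      mul_mem' := mul _ _
      star_mem' := star _ }
  vNGen_le (M := N) closed mem hX

end WOT

/-! ### Operator matrices -/

section Blocks

variable {K G : Type*} [NormedAddCommGroup K] [InnerProductSpace ℂ K] [Fintype G]

/-- The inclusion `k ↦ k ⊗ ε_g` of `K` in `K ⊗ l²(G)`. -/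
def ampInj (g : G) : K →L[ℂ] Amp K G :=
  ((PiLp.continuousLinearEquiv 2 ℂ (fun _ : G => K)).symm : (G → K) →L[ℂ] Amp K G) ∘L
    ContinuousLinearMap.single ℂ (fun _ : G => K) g

theorem ampInj_apply (g h : G) (k : K) : ampInj g k h = if h = g then k else 0 := by
  by_cases hh : h = g
  · subst hh; simp [ampInj]
  · simp [ampInj, hh]

/-- The `(g, h)` entry of the operator matrix of `X`. -/
def blk (X : Op (Amp K G)) (g h : G) : Op K :=
  (PiLp.proj 2 (fun _ : G => K) g : Amp K G →L[ℂ] K) ∘L X ∘L ampInj h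

theorem blk_apply (X : Op (Amp K G)) (g h : G) (k : K) : blk X g h k = X (ampInj h k) g := rfl

theorem sum_ampInj (ξ : Amp K G) : ∑ h, ampInj h (ξ h) = ξ := by
  ext g
  simp [ampInj_apply]

theorem apply_eq_sum_blk (X : Op (Amp K G)) (ξ : Amp K G) (g : G) :
    X ξ g = ∑ h, blk X g h (ξ h) := by
  conv_lhs => rw [← sum_ampInj ξ]
  simp [blk_apply]

theorem blk_ext {X Y : Op (Amp K G)} (h : ∀ g g', blk X g g' = blk Y g g') : X = Y := by
  ext ξ g
  simp only [apply_eq_sum_blk, h]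

@[simp] theorem blk_blockOp (m : G → G → Op K) (g h : G) : blk (blockOp m) g h = m g h := by
  ext k
  simp [blk_apply, ampInj_apply, apply_ite]

theorem blk_mul (X Y : Op (Amp K G)) (g h : G) :
    blk (X * Y) g h = ∑ k, blk X g k * blk Y k h := by
  ext v
  rw [blk_apply, mul_apply_eq_comp, apply_eq_sum_blk]
  simp [blk_apply]

theorem blk_add (X Y : Op (Amp K G)) (g h : G) : blk (X + Y) g h = blk X g h + blk Y g h := rfl

theorem blk_zero (g h : G) : blk (0 : Op (Amp K G)) g h = 0 := rfl

theorem blk_smul (c : ℂ) (X : Op (Amp K G)) (g h : G) : blk (c • X) g h = c • blk X g h := rfl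

theorem blk_sum {ι : Type*} (s : Finset ι) (X : ι → Op (Amp K G)) (g h : G) :
    blk (∑ i ∈ s, X i) g h = ∑ i ∈ s, blk (X i) g h := by
  ext v
  simp [blk_apply]

theorem blk_one (g h : G) : blk (1 : Op (Amp K G)) g h = if g = h then 1 else 0 := by
  ext v
  rw [blk_apply, one_apply_eq_self, ampInj_apply]
  split_ifs <;> rfl

theorem inner_ampInj (g : G) (k : K) (ξ : Amp K G) : ⟪ampInj g k, ξ⟫ = ⟪k, ξ g⟫ := by
  simp only [PiLp.inner_apply, ampInj_apply]
  rw [Finset.sum_eq_single g]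
  · simp
  · intro h _ hh; simp [hh]
  · simp

theorem blk_star [CompleteSpace K] (X : Op (Amp K G)) (g h : G) :
    blk (star X) g h = star (blk X h g) := by
  rw [ContinuousLinearMap.star_eq_adjoint (blk X h g), ContinuousLinearMap.eq_adjoint_iff]
  intro v w
  rw [blk_apply, blk_apply, ← inner_ampInj, ← inner_conj_symm, ← inner_ampInj,
    ContinuousLinearMap.star_eq_adjoint, ContinuousLinearMap.adjoint_inner_right, inner_conj_symm]

theorem wotContinuous_blk (g h : G) : WOTContinuous fun X : Op (Amp K G) => blk X g h :=
  wotContinuous_comp _ _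

theorem entry_eq_blk (T : Op (l2 G)) (g h : G) : entry T g h = blk T g h 1 := by
  rw [blk_apply, entry]
  congr 2

theorem entry_ext {S T : Op (l2 G)} (h : ∀ g g', entry S g g' = entry T g g') : S = T := by
  refine blk_ext fun g g' => ContinuousLinearMap.ext_ring ?_
  rw [← entry_eq_blk, ← entry_eq_blk, h]

theorem entry_mul (S T : Op (l2 G)) (g h : G) :
    entry (S * T) g h = ∑ k, entry S g k * entry T k h := by
  have h1 : ∀ (R : Op ℂ) (z : ℂ), R z = R 1 * z := fun R z => by
    conv_lhs => rw [← mul_one z, ← smul_eq_mul, map_smul, smul_eq_mul, mul_comm]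
  simp only [entry_eq_blk, blk_mul, sum_apply, mul_apply_eq_comp]
  exact Finset.sum_congr rfl fun k _ => h1 _ _

theorem entry_star (T : Op (l2 G)) (g h : G) : entry (star T) g h = star (entry T h g) := by
  rw [entry_eq_blk, entry_eq_blk, blk_star, ContinuousLinearMap.star_eq_adjoint]
  have := ContinuousLinearMap.adjoint_inner_left (blk T h g) 1 (1 : ℂ)
  simpa using congrArg star this

theorem entry_sum {ι : Type*} (s : Finset ι) (T : ι → Op (l2 G)) (g h : G) :
    entry (∑ i ∈ s, T i) g h = ∑ i ∈ s, entry (T i) g h := by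
  simp [entry]

theorem entry_smul (c : ℂ) (T : Op (l2 G)) (g h : G) : entry (c • T) g h = c * entry T g h := rfl

theorem entry_mulOp (f : G → ℂ) (g h : G) : entry (mulOp f) g h = if g = h then f g else 0 := by
  by_cases hh : g = h <;> simp [entry, hh]

theorem entry_opOf {G : Type*} [Fintype G] (f : (G → ℂ) →ₗ[ℂ] (G → ℂ)) (g h : G) :
    entry (opOf f) g h = f (Pi.single h 1) g := by
  rw [entry, opOf_apply]; rfl

theorem entry_one (g h : G) : entry (1 : Op (l2 G)) g h = if g = h then 1 else 0 := by
  rw [entry_eq_blk, blk_one]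
  split_ifs <;> rfl

theorem wotContinuous_entry (g h : G) :
    Continuous fun T : l2 G →WOT[ℂ] l2 G => entry T.toCLM g h := by
  simp only [entry_eq_blk]
  exact (wotContinuous_blk g h).dual_apply 1 (ContinuousLinearMap.id ℂ ℂ)

theorem blk_tens (x : Op K) (T : Op (l2 G)) (g h : G) : blk (tens x T) g h = entry T g h • x := by
  rw [tens, blk_blockOp]

theorem blk_funOp (F : G → Op K) (g h : G) : blk (funOp F) g h = if g = h then F g else 0 := by
  ext v
  rw [blk_apply, funOp_apply, ampInj_apply]
  split_ifs <;> simp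

/-- The entries of an operator on `(K ⊗ l²(G)) ⊗ l²(G)`; the first index belongs to the inner
factor `l²(G)`. -/
def blk₂ (X : Op (Amp (Amp K G) G)) (p q : G × G) : Op K := blk (blk X p.2 q.2) p.1 q.1

theorem blk₂_ext {X Y : Op (Amp (Amp K G) G)} (h : ∀ p q, blk₂ X p q = blk₂ Y p q) : X = Y :=
  blk_ext fun y y' => blk_ext fun x x' => h (x, y) (x', y')

theorem blk₂_mul (X Y : Op (Amp (Amp K G) G)) (p q : G × G) :
    blk₂ (X * Y) p q = ∑ k, blk₂ X p k * blk₂ Y k q := by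
  simp only [blk₂, blk_mul, blk_sum]
  rw [Fintype.sum_prod_type_right]

theorem blk₂_star [CompleteSpace K] (X : Op (Amp (Amp K G) G)) (p q : G × G) :
    blk₂ (star X) p q = star (blk₂ X q p) := by
  simp only [blk₂, blk_star]

theorem blk₂_add (X Y : Op (Amp (Amp K G) G)) (p q : G × G) :
    blk₂ (X + Y) p q = blk₂ X p q + blk₂ Y p q := rfl

theorem blk₂_smul (c : ℂ) (X : Op (Amp (Amp K G) G)) (p q : G × G) :
    blk₂ (c • X) p q = c • blk₂ X p q := rfl

theorem wotContinuous_blk₂ (p q : G × G) :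
    WOTContinuous fun X : Op (Amp (Amp K G) G) => blk₂ X p q :=
  (wotContinuous_blk p.1 q.1).comp (wotContinuous_blk p.2 q.2)

theorem blk₂_leg23 (T : Op (l2 (G × G))) (p q : G × G) :
    blk₂ (leg23 (K := K) T) p q = entry T p q • 1 := by
  simp [blk₂, leg23]

theorem blk₂_tens (X : Op (Amp K G)) (T : Op (l2 G)) (p q : G × G) :
    blk₂ (tens X T) p q = entry T p.2 q.2 • blk X p.1 q.1 := by
  rw [blk₂, blk_tens, blk_smul]

/-- The operator on `(K ⊗ l²(G)) ⊗ l²(G)` with given entries. -/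
def blockOp₂ (m : G × G → G × G → Op K) : Op (Amp (Amp K G) G) :=
  blockOp fun y y' => blockOp fun x x' => m (x, y) (x', y')

theorem blk₂_blockOp₂ (m : G × G → G × G → Op K) (p q : G × G) :
    blk₂ (blockOp₂ m) p q = m p q := by
  simp [blk₂, blockOp₂]

end Blocks

/-! ### Closed graphs of the components of an action -/

section Graph

variable {V : Type*} [Groupoid V] [Finite V] [∀ u v : V, Finite (u ⟶ v)]
  {H : Type*} [NormedAddCommGroup H] [InnerProductSpace ℂ H] [CompleteSpace H]
  {A : VonNeumannAlgebra H} {b : (V → ℂ) →⋆ₐ[ℂ] A.toStarSubalgebra} (α : RightAction A b)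

/-- The component `a ↦ δ(a)(g)` of an action. -/
def RightAction.comp (g : Mor V) : A.toStarSubalgebra →⋆ₙₐ[ℂ] A.toStarSubalgebra where
  toFun a := α.δ a g
  map_zero' := congrFun (map_zero α.δ) g
  map_add' a a' := congrFun (map_add α.δ a a') g
  map_mul' a a' := congrFun (map_mul α.δ a a') g
  map_smul' c a := congrFun (map_smul α.δ c a) g
  map_star' a := congrFun (map_star α.δ a) g

/-- The action as a `*`-homomorphism into the operators on `H ⊗ l²(𝒢)`. -/
def RightAction.opHom : A.toStarSubalgebra →⋆ₙₐ[ℂ] Op (Amp H (Mor V)) where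
  toFun a := funOp fun g => (α.comp g a : Op H)
  map_zero' := by ext; simp [funOp_apply]
  map_add' a a' := by ext; simp [funOp_apply]
  map_mul' a a' := by ext; simp [funOp_apply]
  map_smul' c a := by ext; simp [funOp_apply]
  map_star' a := by
    rw [← funOp_star]
    congr 1
    funext g
    exact congrArg Subtype.val (map_star (α.comp g) a)

/-- The graph of each component of a normal action is closed in the weak operator
topology, although the component need not be weakly continuous. -/
theorem RightAction.isWOTClosed_graph (g : Mor V) {L : Type*} [NormedAddCommGroup L]
    [InnerProductSpace ℂ L] {F F' : Op L → Op H} (hF : WOTContinuous F) (hF' : WOTContinuous F') :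
    IsWOTClosed {X | ∃ a : A.toStarSubalgebra, F X = a ∧ F' X = α.comp g a} := by
  have hdom := fun (η : dominated A α.opHom) (f : StrongDual ℂ H) =>
    exists_functional_of_dominated η.2 (f ∘L (PiLp.proj 2 (fun _ : Mor V => H) g))
  choose ξ f' hf' using hdom
  have heq : {X | ∃ a : A.toStarSubalgebra, F X = a ∧ F' X = α.comp g a} =
      (F ⁻¹' (A : Set (Op H))) ∩ {X | ∀ (η : dominated A α.opHom), X ∈
        {X | ∀ f : StrongDual ℂ H, X ∈
          {X | f (F' X ((η : Amp H (Mor V)) g)) = f' η f (F X (ξ η f))}}} := by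
    ext X
    constructor
    · rintro ⟨a, h1, h2⟩
      refine ⟨by simp [h1], fun η f => ?_⟩
      change f (F' X _) = f' η f (F X _)
      rw [h1, h2, ← hf' η f a]
      simp [RightAction.opHom, funOp_apply]
    · rintro ⟨h1, h2⟩
      refine ⟨⟨F X, h1⟩, rfl, ?_⟩
      have h0 : (F' X - (α.comp g ⟨F X, h1⟩ : Op H)) ∘L
          (PiLp.proj 2 (fun _ : Mor V => H) g : Amp H (Mor V) →L[ℂ] H) = 0 := by
        refine eq_zero_of_dominated (φ := α.opHom) α.normal _ fun η hη => ?_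
        have hsep : ∀ f : StrongDual ℂ H,
            f (F' X (η g)) = f ((α.comp g ⟨F X, h1⟩ : Op H) (η g)) := fun f => by
          have h3 : f (F' X (η g)) = f' ⟨η, hη⟩ f (F X (ξ ⟨η, hη⟩ f)) := h2 ⟨η, hη⟩ f
          rw [h3]
          have h4 := hf' ⟨η, hη⟩ f ⟨F X, h1⟩
          simpa [RightAction.opHom, funOp_apply] using h4.symm
        have := (SeparatingDual.eq_iff_forall_dual_eq (R := ℂ)).2 hsep
        simpa [sub_eq_zero] using this
      ext v
      have := DFunLike.congr_fun h0 (ampInj g v)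
      simpa [ampInj_apply, sub_eq_zero] using this
  rw [heq]
  refine ((isWOTClosed_vonNeumannAlgebra A).preimage hF).inter
    (IsWOTClosed.iInter fun η => IsWOTClosed.iInter fun f => ?_)
  exact isClosed_eq (hF'.dual_apply _ _) (hF.dual_apply _ _)

end Graph

/-! ### Products in a groupoid -/

section Products

variable {V : Type*} [Groupoid V]

/-- The unit of the groupoid at the object `u`. -/
def Mor.one (u : V) : Mor V := ⟨u, u, 𝟙 u⟩

/-- The relation `x y = z`: the elements `x` and `y` are composable with product `z`. -/
def Mor.IsProd (x y z : Mor V) : Prop := ∃ h : x.s = y.r, x.comp y h = z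

theorem Mor.comp_mk {a b c : V} (f : b ⟶ c) (g : a ⟶ b) (h : b = b) :
    Mor.comp ⟨b, c, f⟩ ⟨a, b, g⟩ h = ⟨a, c, g ≫ f⟩ := by
  simp [Mor.comp]

namespace Mor.IsProd

variable {x y z w t p q : Mor V}

theorem s_eq_r (h : IsProd x y z) : x.s = y.r := h.choose

theorem s_eq (h : IsProd x y z) : z.s = y.s := by obtain ⟨h, rfl⟩ := h; rfl

theorem r_eq (h : IsProd x y z) : z.r = x.r := by obtain ⟨h, rfl⟩ := h; rfl

theorem unique (h : IsProd x y z) (h' : IsProd x y w) : z = w := by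
  obtain ⟨h, rfl⟩ := h
  obtain ⟨h', rfl⟩ := h'
  rfl

theorem inv_left (h : IsProd x y z) : IsProd x.inv z y := by
  obtain ⟨h, rfl⟩ := h
  obtain ⟨b, c, f⟩ := x
  obtain ⟨a, b', g⟩ := y
  cases h
  exact ⟨rfl, by simp [Mor.comp, Mor.inv]⟩

theorem inv_right (h : IsProd x y z) : IsProd z y.inv x := by
  obtain ⟨h, rfl⟩ := h
  obtain ⟨b, c, f⟩ := x
  obtain ⟨a, b', g⟩ := y
  cases h
  exact ⟨rfl, by simp [Mor.comp, Mor.inv]⟩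

theorem unique_right (h : IsProd x y z) (h' : IsProd x w z) : y = w :=
  h.inv_left.unique h'.inv_left

theorem unique_left (h : IsProd x y z) (h' : IsProd w y z) : x = w :=
  h.inv_right.unique h'.inv_right

theorem assoc (h : IsProd x y z) (h' : IsProd z w t) : ∃ p, IsProd y w p ∧ IsProd x p t := by
  obtain ⟨h, rfl⟩ := h
  obtain ⟨h', rfl⟩ := h'
  obtain ⟨b, c, f⟩ := x
  obtain ⟨a, b', g⟩ := y
  obtain ⟨d, e, k⟩ := w
  cases h
  cases h'
  exact ⟨_, ⟨rfl, rfl⟩, rfl, by simp [Mor.comp_mk]⟩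

theorem assoc' (h : IsProd y w p) (h' : IsProd x p t) : ∃ z, IsProd x y z ∧ IsProd z w t := by
  obtain ⟨h, rfl⟩ := h
  obtain ⟨h', rfl⟩ := h'
  obtain ⟨b, c, f⟩ := x
  obtain ⟨a, b', g⟩ := y
  obtain ⟨d, e, k⟩ := w
  cases h
  cases h'
  exact ⟨_, ⟨rfl, rfl⟩, rfl, by simp [Mor.comp_mk]⟩

end Mor.IsProd

theorem Mor.isProd_one_left (x : Mor V) : IsProd (one x.r) x x :=
  ⟨rfl, by obtain ⟨a, b, f⟩ := x; simp [Mor.comp_mk, Mor.one]⟩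

theorem Mor.isProd_one_right (x : Mor V) : IsProd x (one x.s) x :=
  ⟨rfl, by obtain ⟨a, b, f⟩ := x; simp [Mor.comp_mk, Mor.one]⟩

theorem Mor.exists_isProd {x y : Mor V} (h : x.s = y.r) : ∃ z, IsProd x y z := ⟨_, h, rfl⟩

theorem Mor.exists_isProd_left {y z : Mor V} (h : z.s = y.s) : ∃ x, IsProd x y z := by
  obtain ⟨x, hx⟩ := Mor.exists_isProd (x := z) (y := y.inv) h
  refine ⟨x, ?_⟩
  have := hx.inv_right
  rwa [show y.inv.inv = y by simp [Mor.inv]] at this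

theorem Mor.exists_isProd_right {x z : Mor V} (h : z.r = x.r) : ∃ y, IsProd x y z := by
  obtain ⟨y, hy⟩ := Mor.exists_isProd (x := x.inv) (y := z) h.symm
  refine ⟨y, ?_⟩
  have := hy.inv_left
  rwa [show x.inv.inv = x by simp [Mor.inv]] at this

variable [Finite V] [∀ u v : V, Finite (u ⟶ v)]

open Mor (IsProd)

theorem entry_rho (g t t' : Mor V) : entry (rho g) t t' = if IsProd t g t' then 1 else 0 := by
  rw [rho, entry_opOf]
  simp only [LinearMap.coe_mk, AddHom.coe_mk, Pi.single_apply]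
  by_cases h : t.s = g.r
  · simp [h, IsProd]
  · simp [h, IsProd]

theorem entry_mpiTilde (p q : Mor V × Mor V) :
    entry (mpiTilde V) p q = if p.1 = q.1 ∧ IsProd q.2 p.1 p.2 then 1 else 0 := by
  obtain ⟨x, y⟩ := p
  obtain ⟨x', y'⟩ := q
  have hiff : IsProd y' x y ↔ IsProd y x.inv y' := ⟨fun h => h.inv_right, fun h => by
    have := h.inv_right
    rwa [show x.inv.inv = x by simp [Mor.inv]] at this⟩
  rw [entry, mpiTilde_apply]
  simp only [hiff]
  by_cases h : y.s = x.s
  · have h' : y.s = x.inv.r := h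
    simp only [h, dite_true, IsProd]
    rw [PiLp.single_apply]
    simp only [Prod.mk.injEq]
    refine if_congr (and_congr_right fun _ => ⟨fun e => ⟨rfl, e⟩, fun ⟨_, e⟩ => e⟩) rfl rfl
  · have h' : ¬ y.s = x.inv.r := h
    simp [h, IsProd, h']

end Products

/-! ### The Weyl algebra -/

section Weyl

variable {V : Type*} [Groupoid V] [Finite V] [∀ u v : V, Finite (u ⟶ v)]

open Mor (IsProd)

theorem mem_Weyl_iff {T : Op (l2 (Mor V))} :
    T ∈ Weyl V ↔ ∀ t t' : Mor V, t.r ≠ t'.r → entry T t t' = 0 := by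
  have hcomm : ∀ n : V → ℂ, rOp n * T = T * rOp n ↔
      ∀ t t' : Mor V, n t.r * entry T t t' = entry T t t' * n t'.r := by
    intro n
    have h1 : ∀ t t', entry (rOp n * T) t t' = n t.r * entry T t t' := fun t t' => by
      simp [entry_mul, rOp, entry_mulOp]
    have h2 : ∀ t t', entry (T * rOp n) t t' = entry T t t' * n t'.r := fun t t' => by
      simp [entry_mul, rOp, entry_mulOp]
    refine ⟨fun h t t' => by rw [← h1, ← h2, h], fun h => entry_ext fun t t' => ?_⟩
    rw [h1, h2, h]
  have hstar : ∀ n : V → ℂ, star (rOp (V := V) n) = rOp (star n) := fun n => by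
    refine entry_ext fun t t' => ?_
    rw [entry_star, rOp, rOp, entry_mulOp, entry_mulOp]
    by_cases h : t = t'
    · simp [h]
    · simp [h, Ne.symm h]
  rw [Weyl, StarSubalgebra.mem_centralizer_iff]
  constructor
  · intro h t t' hne
    have := (hcomm _).1 (h _ ⟨dirac t.r, rfl⟩).1 t t'
    simpa [dirac, hne.symm] using this
  · intro h
    have key : ∀ n : V → ℂ, rOp n * T = T * rOp n := fun n => (hcomm n).2 fun t t' => by
      by_cases hne : t.r = t'.r
      · rw [hne, mul_comm]
      · simp [h t t' hne]
    rintro _ ⟨n, rfl⟩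
    exact ⟨key n, by rw [hstar]; exact key _⟩

theorem isWOTClosed_Weyl : IsWOTClosed (Weyl V : Set (Op (l2 (Mor V)))) := by
  have : (Weyl V : Set (Op (l2 (Mor V)))) = {T | ∀ t, T ∈ {T | ∀ t' : Mor V, T ∈
      {T | (t : Mor V).r ≠ t'.r → T ∈ {T | entry T t t' = 0}}}} := by
    ext T
    exact mem_Weyl_iff
  rw [this]
  refine IsWOTClosed.iInter fun t => IsWOTClosed.iInter fun t' => IsWOTClosed.setOf_imp fun _ => ?_
  exact isClosed_eq (wotContinuous_entry t t') continuous_const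

/-- The matrix units of the Weyl algebra are the products `δ_t ρ(t⁻¹ t')`. -/
theorem mulOp_dirac_mul_rho {t t' g : Mor V} (h : IsProd t g t') (x x' : Mor V) :
    entry (mulOp (dirac t) * rho g) x x' = if x = t ∧ x' = t' then 1 else 0 := by
  simp only [entry_mul, entry_mulOp, entry_rho, ite_mul, zero_mul, Finset.sum_ite_eq,
    Finset.mem_univ, if_true]
  by_cases hx : x = t
  · subst hx
    have : IsProd x g x' ↔ x' = t' := ⟨fun h' => h'.unique h, fun h' => h' ▸ h⟩
    simp [dirac, this]
  · simp [dirac, hx]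

theorem Weyl_le_span : (Weyl V : Set (Op (l2 (Mor V)))) ⊆
    Submodule.span ℂ {X | ∃ S ∈ CG V, ∃ T ∈ RG V, X = S * T} := by
  intro T hT
  have hunit : ∀ t t' : Mor V, ∃ X ∈ Submodule.span ℂ
      {X : Op (l2 (Mor V)) | ∃ S ∈ CG V, ∃ T ∈ RG V, X = S * T},
      ∀ x x', entry X x x' = if x = t ∧ x' = t' then entry T t t' else 0 := by
    intro t t'
    by_cases hr : t'.r = t.r
    · obtain ⟨g, hg⟩ := Mor.exists_isProd_right hr
      refine ⟨entry T t t' • (mulOp (dirac t) * rho g), Submodule.smul_mem _ _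
        (Submodule.subset_span ⟨_, ⟨_, rfl⟩, _, Submodule.subset_span ⟨g, rfl⟩, rfl⟩), ?_⟩
      intro x x'
      rw [entry_smul, mulOp_dirac_mul_rho hg]
      simp
    · refine ⟨0, zero_mem _, fun x x' => ?_⟩
      rw [mem_Weyl_iff.1 hT t t' (Ne.symm hr)]
      simp [entry]
  choose X hX hX' using hunit
  have : T = ∑ t, ∑ t', X t t' := by
    refine entry_ext fun x x' => ?_
    simp only [entry_sum, hX']
    rw [Finset.sum_eq_single x, Finset.sum_eq_single x']
    · simp
    · intro t' _ ht'; simp [ht'.symm]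
    · simp
    · intro t _ ht; simp [ht.symm]
    · simp
  rw [this]
  exact sum_mem fun t _ => sum_mem fun t' _ => hX t t'

theorem span_le_vNGen : (Submodule.span ℂ {X | ∃ S ∈ CG V, ∃ T ∈ RG V, X = S * T} :
      Set (Op (l2 (Mor V)))) ⊆ vNGen (CG V ∪ RG V) := by
  let N : NonUnitalStarSubalgebra ℂ (Op (l2 (Mor V))) := vNGen (CG V ∪ RG V)
  change Submodule.span ℂ _ ≤ N.toNonUnitalSubalgebra.toSubmodule
  rw [Submodule.span_le]
  rintro _ ⟨S, hS, T, hT, rfl⟩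
  exact mul_mem (S := NonUnitalStarSubalgebra ℂ (Op (l2 (Mor V)))) (s := N)
    (subset_vNGen _ (Or.inl hS)) (subset_vNGen _ (Or.inr hT))

theorem vNGen_le_Weyl : (vNGen (CG V ∪ RG V) : Set (Op (l2 (Mor V)))) ⊆ Weyl V := by
  refine vNGen_le (M := (Weyl V).toNonUnitalStarSubalgebra) isWOTClosed_Weyl ?_
  rintro T (⟨f, rfl⟩ | hT)
  · refine mem_Weyl_iff.2 fun t t' h => ?_
    rw [entry_mulOp, if_neg]
    rintro rfl
    exact h rfl
  · have : Submodule.span ℂ (Set.range (rho (V := V))) ≤ (Weyl V).toSubalgebra.toSubmodule := by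
      rw [Submodule.span_le]
      rintro _ ⟨g, rfl⟩
      refine mem_Weyl_iff.2 fun t t' h => ?_
      rw [entry_rho, if_neg]
      exact fun hp => h hp.r_eq.symm
    exact this hT

end Weyl

/-! ### Coefficient matrices and their inflation -/

section Action

open Mor (IsProd one)

variable {V : Type*} [Groupoid V] [Finite V] [∀ u v : V, Finite (u ⟶ v)]
  {H : Type*} [NormedAddCommGroup H] [InnerProductSpace ℂ H] [CompleteSpace H]
  {A : VonNeumannAlgebra H} {b : (V → ℂ) →⋆ₐ[ℂ] A.toStarSubalgebra}

theorem blk_eB (g h : Mor V) :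
    blk (eB b) g h = if g = h then ((b (dirac g.r) : A.toStarSubalgebra) : Op H) else 0 := by
  let _ := Fintype.ofFinite V
  have h1 : blk (eB b) g h = ∑ u : V, entry (rOp (dirac u)) g h •
      ((b (dirac u) : A.toStarSubalgebra) : Op H) := by
    rw [eB, eProj, blk_sum]
    simp only [blk_tens]
  rw [h1]
  by_cases hgh : g = h
  · simp [rOp, entry_mulOp, hgh, dirac]
  · simp [rOp, entry_mulOp, hgh]

theorem blk_eB_mul_tens (T : Op (l2 (Mor V))) (g h : Mor V) :
    blk (eB b * tens 1 T) g h = entry T g h • ((b (dirac g.r) : A.toStarSubalgebra) : Op H) := by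
  simp [blk_mul, blk_eB, blk_tens]

variable (α : RightAction A b)

theorem blk_op (a : A.toStarSubalgebra) (g h : Mor V) :
    blk (α.op a) g h = if g = h then (α.comp g a : Op H) else 0 :=
  blk_funOp _ g h

namespace RightAction

theorem comp_base (g : Mor V) (n : V → ℂ) : α.comp g (b n) = n g.s • b (dirac g.r) := by
  have h1 : (α.op (b n)) = eB b * tens 1 (mulOp (antipode fun x => n x.r)) := α.base n
  have h2 := congrArg (fun X => blk X g g) h1
  simp only [blk_op, blk_eB_mul_tens, entry_mulOp, if_true] at h2
  exact Subtype.ext h2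

theorem comp_one (g : Mor V) : α.comp g 1 = b (dirac g.r) := by
  rw [← map_one b, comp_base]; simp

theorem comp_comp {x y z : Mor V} (h : IsProd x y z) (a : A.toStarSubalgebra) :
    α.comp x (α.comp y a) = α.comp z a := by
  obtain ⟨h, rfl⟩ := h
  exact (α.coassoc a x y).trans (dif_pos h)

theorem comp_comp_of_ne {x y : Mor V} (h : x.s ≠ y.r) (a : A.toStarSubalgebra) :
    α.comp x (α.comp y a) = 0 :=
  (α.coassoc a x y).trans (dif_neg h)

theorem comp_comp_one (g : Mor V) (a : A.toStarSubalgebra) :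
    α.comp g (α.comp (one g.s) a) = α.comp g a :=
  α.comp_comp g.isProd_one_right a

theorem comp_one_comp (g : Mor V) (a : A.toStarSubalgebra) :
    α.comp (one g.r) (α.comp g a) = α.comp g a :=
  α.comp_comp g.isProd_one_left a

theorem comp_one_comp_of_ne {u : V} {g : Mor V} (h : u ≠ g.r) (a : A.toStarSubalgebra) :
    α.comp (one u) (α.comp g a) = 0 :=
  α.comp_comp_of_ne h a

/-- The units of the groupoid separate the points of `A`: they decompose it as a direct sum. -/
theorem eq_of_comp_one {a a' : A.toStarSubalgebra}
    (h : ∀ u : V, α.comp (one u) a = α.comp (one u) a') : a = a' := by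
  refine α.injective (funext fun g => ?_)
  change α.comp g a = α.comp g a'
  rw [← comp_comp_one, h, comp_comp_one]

theorem base_mul (u : V) (a : A.toStarSubalgebra) : b (dirac u) * a = α.comp (one u) a := by
  have h1 : b (dirac u) = α.comp (one u) 1 := (α.comp_one (one u)).symm
  refine α.eq_of_comp_one fun v => ?_
  rw [map_mul, h1]
  by_cases h : v = u
  · subst h
    have h2 := fun a => α.comp_one_comp (one v) a
    change ∀ a, α.comp (one v) (α.comp (one v) a) = _ at h2
    rw [h2, h2, ← map_mul, one_mul]
  · rw [α.comp_one_comp_of_ne (g := one u) h, α.comp_one_comp_of_ne (g := one u) h, zero_mul]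

theorem mul_base (u : V) (a : A.toStarSubalgebra) : a * b (dirac u) = α.comp (one u) a := by
  have h1 : b (dirac u) = α.comp (one u) 1 := (α.comp_one (one u)).symm
  refine α.eq_of_comp_one fun v => ?_
  rw [map_mul, h1]
  by_cases h : v = u
  · subst h
    have h2 := fun a => α.comp_one_comp (one v) a
    change ∀ a, α.comp (one v) (α.comp (one v) a) = _ at h2
    rw [h2, h2, ← map_mul, mul_one]
  · rw [α.comp_one_comp_of_ne (g := one u) h, α.comp_one_comp_of_ne (g := one u) h, mul_zero]

end RightAction

/-- The matrices over `A`, indexed by `𝒢`, whose `(y, y')` entry lies in the summands of `A` at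
`r(y)` and at `r(y')`. Both the double crossed product and the reduced Weyl algebra are faithful
images of this `*`-algebra. -/
def RightAction.coefficients :
    NonUnitalStarSubalgebra ℂ (Matrix (Mor V) (Mor V) A.toStarSubalgebra) where
  carrier := {m | ∀ y y', α.comp (one y.r) (m y y') = m y y' ∧ α.comp (one y'.r) (m y y') = m y y'}
  add_mem' {m n} hm hn y y' := by
    simp only [Matrix.add_apply, map_add, hm y y', hn y y', and_self]
  zero_mem' y y' := by simp
  smul_mem' c m hm y y' := by
    simp only [Matrix.smul_apply, map_smul, hm y y', and_self]
  mul_mem' {m n} hm hn y y' := by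
    simp only [Matrix.mul_apply]
    constructor
    · rw [map_sum]
      refine Finset.sum_congr rfl fun k _ => ?_
      rw [← α.base_mul, ← mul_assoc, α.base_mul, (hm y k).1]
    · rw [map_sum]
      refine Finset.sum_congr rfl fun k _ => ?_
      rw [← α.mul_base, mul_assoc, α.mul_base, (hn k y').2]
  star_mem' {m} hm y y' := by
    simp only [Matrix.star_apply, map_star, hm y' y, and_self]

variable {α}

theorem RightAction.comp_eq_zero_of_mem {m : Matrix (Mor V) (Mor V) A.toStarSubalgebra}
    (hm : m ∈ α.coefficients) {w y y' : Mor V} (h : w.s ≠ y.r ∨ w.s ≠ y'.r) :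
    α.comp w (m y y') = 0 := by
  rcases h with h | h
  · rw [← (hm y y').1, α.comp_comp_of_ne (y := one y.r) h]
  · rw [← (hm y y').2, α.comp_comp_of_ne (y := one y'.r) h]

theorem RightAction.apply_eq_zero_of_mem {m : Matrix (Mor V) (Mor V) A.toStarSubalgebra}
    (hm : m ∈ α.coefficients) {y y' : Mor V} (h : y.r ≠ y'.r) : m y y' = 0 := by
  rw [← (hm y y').1]
  exact comp_eq_zero_of_mem hm (Or.inr h)

variable (α)

/-- The action of all elements `w` of `𝒢` on a matrix, as the operator that sends the fibre of
`{(x, y) : s(x) = s(y)}` over `w = x y⁻¹` to itself with entries `δ_w(m(y, y'))`. -/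
def RightAction.inflate (m : Matrix (Mor V) (Mor V) A.toStarSubalgebra) :
    Op (Amp (Amp H (Mor V)) (Mor V)) :=
  blockOp₂ fun p q => ∑ w : Mor V,
    if IsProd w p.2 p.1 ∧ IsProd w q.2 q.1 then (α.comp w (m p.2 q.2) : Op H) else 0

namespace RightAction

theorem blk₂_inflate (m : Matrix (Mor V) (Mor V) A.toStarSubalgebra) {w : Mor V}
    {p q : Mor V × Mor V} (hp : IsProd w p.2 p.1) (hq : IsProd w q.2 q.1) :
    blk₂ (α.inflate m) p q = α.comp w (m p.2 q.2) := by
  rw [inflate, blk₂_blockOp₂, Finset.sum_eq_single w, if_pos ⟨hp, hq⟩]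
  · intro w' _ hne
    exact if_neg fun h => hne (h.1.unique_left hp)
  · simp

theorem blk₂_inflate_eq_zero (m : Matrix (Mor V) (Mor V) A.toStarSubalgebra)
    {p q : Mor V × Mor V} (h : ∀ w, IsProd w p.2 p.1 → ¬ IsProd w q.2 q.1) :
    blk₂ (α.inflate m) p q = 0 := by
  rw [inflate, blk₂_blockOp₂]
  exact Finset.sum_eq_zero fun w _ => if_neg fun h' => h w h'.1 h'.2

/-- An operator is an inflation as soon as it has the right entries. -/
theorem eq_inflate {X : Op (Amp (Amp H (Mor V)) (Mor V))}
    {m : Matrix (Mor V) (Mor V) A.toStarSubalgebra}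
    (h1 : ∀ w p q, IsProd w p.2 p.1 → IsProd w q.2 q.1 → blk₂ X p q = α.comp w (m p.2 q.2))
    (h2 : ∀ p q, (∀ w, IsProd w p.2 p.1 → ¬ IsProd w q.2 q.1) → blk₂ X p q = 0) :
    X = α.inflate m := by
  refine blk₂_ext fun p q => ?_
  by_cases h : ∃ w, IsProd w p.2 p.1 ∧ IsProd w q.2 q.1
  · obtain ⟨w, hp, hq⟩ := h
    rw [h1 w p q hp hq, α.blk₂_inflate m hp hq]
  · push Not at h
    rw [h2 p q h, α.blk₂_inflate_eq_zero m h]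

theorem inflate_mul {m n : Matrix (Mor V) (Mor V) A.toStarSubalgebra} (hm : m ∈ α.coefficients) :
    α.inflate m * α.inflate n = α.inflate (m * n) := by
  refine α.eq_inflate (fun w p q hp hq => ?_) fun p q h => ?_
  · rw [blk₂_mul, Fintype.sum_prod_type_right, Matrix.mul_apply, map_sum,
      AddSubmonoidClass.coe_finsetSum]
    refine Finset.sum_congr rfl fun y _ => ?_
    by_cases hy : w.s = y.r
    · obtain ⟨x, hx⟩ := Mor.exists_isProd hy
      rw [Finset.sum_eq_single x, α.blk₂_inflate m hp (q := (x, y)) hx,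
        α.blk₂_inflate n (p := (x, y)) hx hq, map_mul]
      · rfl
      · intro x' _ hne
        rw [α.blk₂_inflate_eq_zero m, zero_mul]
        intro w' hw' hx'
        exact hne (hx'.unique (hp.unique_left hw' ▸ hx))
      · simp
    · rw [map_mul, comp_eq_zero_of_mem hm (Or.inr hy), zero_mul]
      refine Finset.sum_eq_zero fun x _ => ?_
      rw [α.blk₂_inflate_eq_zero m, zero_mul]
      intro w' hw' hx'
      exact hy (hp.unique_left hw' ▸ hx'.s_eq_r)
  · rw [blk₂_mul]
    refine Finset.sum_eq_zero fun k _ => ?_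
    by_cases hk : ∃ w, IsProd w p.2 p.1 ∧ IsProd w k.2 k.1
    · obtain ⟨w, hw, hwk⟩ := hk
      rw [α.blk₂_inflate_eq_zero n (p := k), mul_zero]
      intro w' hw' hq
      exact h w hw (hw'.unique_left hwk ▸ hq)
    · push Not at hk
      rw [α.blk₂_inflate_eq_zero m hk, zero_mul]

theorem inflate_star (m : Matrix (Mor V) (Mor V) A.toStarSubalgebra) :
    star (α.inflate m) = α.inflate (star m) := by
  refine α.eq_inflate (fun w p q hp hq => ?_) fun p q h => ?_
  · rw [blk₂_star, α.blk₂_inflate m hq hp, Matrix.star_apply, map_star]; rfl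
  · rw [blk₂_star, α.blk₂_inflate_eq_zero m, star_zero]
    exact fun w h1 h2 => h w h2 h1

/-- Inflation as a `*`-homomorphism on the coefficient matrices; for general matrices the operator
entries with `s(w) ≠ r(y')` would be lost and multiplicativity would fail. -/
def inflateHom : α.coefficients →⋆ₙₐ[ℂ] Op (Amp (Amp H (Mor V)) (Mor V)) where
  toFun m := α.inflate m
  map_zero' := (α.eq_inflate (fun _ _ _ _ _ => by simp [blk₂, blk_zero])
    fun _ _ _ => rfl).symm
  map_add' m n := (α.eq_inflate (fun w p q hp hq => by
    rw [blk₂_add, α.blk₂_inflate _ hp hq, α.blk₂_inflate _ hp hq]; simp) fun p q h => by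
    rw [blk₂_add, α.blk₂_inflate_eq_zero _ h, α.blk₂_inflate_eq_zero _ h, add_zero]).symm
  map_smul' c m := (α.eq_inflate (fun w p q hp hq => by
    rw [blk₂_smul, MonoidHom.id_apply, α.blk₂_inflate _ hp hq]; simp) fun p q h => by
    rw [blk₂_smul, α.blk₂_inflate_eq_zero _ h, smul_zero]).symm
  map_mul' m n := (α.inflate_mul m.2).symm
  map_star' m := (α.inflate_star m).symm

theorem blk₂_inflate_diag {m : Matrix (Mor V) (Mor V) A.toStarSubalgebra}
    (hm : m ∈ α.coefficients) (y y' : Mor V) :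
    blk₂ (α.inflate m) (y, y) (y', y') = m y y' := by
  by_cases h : y.r = y'.r
  · rw [α.blk₂_inflate m (w := one y.r) y.isProd_one_left (h ▸ y'.isProd_one_left), (hm y y').1]
  · rw [apply_eq_zero_of_mem hm h, α.blk₂_inflate_eq_zero]
    · rfl
    · intro w h1 h2
      exact h (h1.r_eq.trans h2.r_eq.symm)

theorem inflateHom_injective : Function.Injective α.inflateHom := fun m n h => by
  refine Subtype.ext (Matrix.ext fun y y' => Subtype.ext ?_)
  rw [← α.blk₂_inflate_diag m.2, ← α.blk₂_inflate_diag n.2]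
  exact congrArg (fun X => blk₂ X (y, y) (y', y')) h

/-- Membership in the range of the inflation is a condition on pairs of entries, each of which puts
a pair in the graph of a component of the action. -/
theorem isWOTClosed_range_inflateHom : IsWOTClosed (Set.range α.inflateHom) := by
  have heq : Set.range α.inflateHom =
      {X | ∀ w : Mor V, X ∈ {X | ∀ p : Mor V × Mor V, X ∈ {X | ∀ q : Mor V × Mor V, X ∈
        {X | IsProd w p.2 p.1 ∧ IsProd w q.2 q.1 → X ∈ {X | ∃ a : A.toStarSubalgebra,
          blk₂ X (p.2, p.2) (q.2, q.2) = a ∧ blk₂ X p q = α.comp w a}}}}} ∩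
      {X | ∀ p : Mor V × Mor V, X ∈ {X | ∀ q : Mor V × Mor V, X ∈
        {X | (∀ w, IsProd w p.2 p.1 → ¬ IsProd w q.2 q.1) → X ∈ {X | blk₂ X p q = 0}}}} := by
    ext X
    constructor
    · rintro ⟨m, rfl⟩
      refine ⟨fun w p q h => ⟨m.1 p.2 q.2, α.blk₂_inflate_diag m.2 _ _,
        α.blk₂_inflate _ h.1 h.2⟩, fun p q h => α.blk₂_inflate_eq_zero _ h⟩
    · rintro ⟨h1, h2⟩
      have hA : ∀ y y', ∃ a : A.toStarSubalgebra, blk₂ X (y, y) (y', y') = a ∧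
          α.comp (one y.r) a = a ∧ α.comp (one y'.r) a = a := by
        intro y y'
        by_cases h : y.r = y'.r
        · obtain ⟨a, ha, ha'⟩ := h1 (one y.r) (y, y) (y', y')
            ⟨y.isProd_one_left, h ▸ y'.isProd_one_left⟩
          have : α.comp (one y.r) a = a := Subtype.ext (ha'.symm.trans ha)
          exact ⟨a, ha, this, h ▸ this⟩
        · exact ⟨0, h2 (y, y) (y', y') fun w hw hw' => h (hw.r_eq.trans hw'.r_eq.symm), by simp⟩
      choose m hm hm' using hA
      refine ⟨⟨m, hm'⟩, (α.eq_inflate (fun w p q hp hq => ?_) h2).symm⟩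
      obtain ⟨a, ha, ha'⟩ := h1 w p q ⟨hp, hq⟩
      rw [ha']
      have : a = m p.2 q.2 := Subtype.ext (ha.symm.trans (hm _ _))
      rw [this]
  rw [heq]
  refine IsWOTClosed.inter ?_ ?_
  · exact IsWOTClosed.iInter fun w => IsWOTClosed.iInter fun p => IsWOTClosed.iInter fun q =>
      IsWOTClosed.setOf_imp fun _ => α.isWOTClosed_graph w (wotContinuous_blk₂ _ _)
        (wotContinuous_blk₂ _ _)
  · exact IsWOTClosed.iInter fun p => IsWOTClosed.iInter fun q =>
      IsWOTClosed.setOf_imp fun _ => isWOTClosed_eq (wotContinuous_blk₂ _ _) (wotContinuous_const 0)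

end RightAction

end Action

section Blocks

variable {K L G : Type*} [NormedAddCommGroup K] [InnerProductSpace ℂ K] [NormedAddCommGroup L]
  [InnerProductSpace ℂ L] [Fintype G]

theorem wotContinuous_of_blk {F : Op K → Op (Amp L G)}
    (h : ∀ g g', WOTContinuous fun X => blk (F X) g g') : WOTContinuous F := by
  refine ContinuousLinearMapWOT.continuous_of_dual_apply_continuous fun ξ f => ?_
  have heq : ∀ X : Op K, f (F X ξ) = ∑ g, ∑ g', (f ∘L ampInj g) (blk (F X) g g' (ξ g')) := by
    intro X
    conv_lhs => rw [← sum_ampInj (F X ξ)]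
    simp [apply_eq_sum_blk]
  simp only [ContinuousLinearMapWOT.ofCLM_apply, heq]
  exact continuous_finsetSum _ fun g _ => continuous_finsetSum _ fun g' _ =>
    (h g g').dual_apply _ _

end Blocks

/-- The case of `zero_mem` for algebras of operators, stated for a general space because instance
search is slow on iterated tensor products. -/
theorem zero_mem_of_op {K : Type*} [NormedAddCommGroup K] [InnerProductSpace ℂ K]
    [CompleteSpace K] (M : NonUnitalStarSubalgebra ℂ (Op K)) : (0 : Op K) ∈ M :=
  zero_mem M

/-! ### The reduced Weyl algebra -/

section Corner

open Mor (IsProd one)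

variable {V : Type*} [Groupoid V] [Finite V] [∀ u v : V, Finite (u ⟶ v)]
  {H : Type*} [NormedAddCommGroup H] [InnerProductSpace ℂ H] [CompleteSpace H]
  {A : VonNeumannAlgebra H} {b : (V → ℂ) →⋆ₐ[ℂ] A.toStarSubalgebra} (α : RightAction A b)

/-- The operators on `H ⊗ l²(𝒢)` whose entries lie in `A` and vanish unless the two indices have
the same range. -/
def rangeDiagonal (V : Type*) [Groupoid V] [Finite V] [∀ u v : V, Finite (u ⟶ v)]
    (A : VonNeumannAlgebra H) : NonUnitalStarSubalgebra ℂ (Op (Amp H (Mor V))) where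
  carrier := {Z | ∀ y y', blk Z y y' ∈ A ∧ (y.r ≠ y'.r → blk Z y y' = 0)}
  add_mem' {X Y} hX hY y y' := by
    rw [blk_add]
    exact ⟨add_mem (hX y y').1 (hY y y').1, fun h => by
      rw [(hX y y').2 h, (hY y y').2 h, add_zero]⟩
  zero_mem' y y' := ⟨zero_mem A, fun _ => rfl⟩
  smul_mem' c X hX y y' := by
    rw [blk_smul]
    exact ⟨A.toStarSubalgebra.smul_mem (hX y y').1 c, fun h => by rw [(hX y y').2 h, smul_zero]⟩
  mul_mem' {X Y} hX hY y y' := by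
    rw [blk_mul]
    refine ⟨sum_mem fun k _ => mul_mem (hX y k).1 (hY k y').1, fun h =>
      Finset.sum_eq_zero fun k _ => ?_⟩
    by_cases hk : y.r = k.r
    · rw [(hY k y').2 (hk ▸ h), mul_zero]
    · rw [(hX y k).2 hk, zero_mul]
  star_mem' {X} hX y y' := by
    rw [blk_star]
    exact ⟨star_mem (hX y' y).1, fun h => by rw [(hX y' y).2 h.symm, star_zero]⟩

theorem vNTensor_Weyl_le :
    vNTensor (A : Set (Op H)) (Weyl V : Set (Op (l2 (Mor V)))) ≤ rangeDiagonal V A := by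
  refine vNGen_le ?_ ?_
  · have : (rangeDiagonal V A : Set (Op (Amp H (Mor V)))) = {Z | ∀ y : Mor V, Z ∈ {Z | ∀ y' : Mor V,
        Z ∈ (fun Z => blk Z y y') ⁻¹' (A : Set (Op H)) ∩
          {Z | y.r ≠ y'.r → Z ∈ {Z | blk Z y y' = 0}}}} := rfl
    rw [this]
    exact IsWOTClosed.iInter fun y => IsWOTClosed.iInter fun y' =>
      ((isWOTClosed_vonNeumannAlgebra A).preimage (wotContinuous_blk y y')).inter
        (IsWOTClosed.setOf_imp fun _ => isWOTClosed_eq (wotContinuous_blk y y')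
          (wotContinuous_const 0))
  · rintro _ ⟨a, ha, T, hT, rfl⟩ y y'
    rw [blk_tens]
    exact ⟨A.toStarSubalgebra.smul_mem ha _, fun h => by rw [mem_Weyl_iff.1 hT y y' h, zero_smul]⟩

namespace RightAction

/-- The coefficient matrices as operators on `H ⊗ l²(𝒢)`. -/
def blockHom : α.coefficients →⋆ₙₐ[ℂ] Op (Amp H (Mor V)) where
  toFun m := blockOp fun y y' => (m.1 y y' : Op H)
  map_zero' := blk_ext fun y y' => by rw [blk_blockOp]; rfl
  map_add' m n := blk_ext fun y y' => by simp only [blk_add, blk_blockOp]; rfl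
  map_smul' c m := blk_ext fun y y' => by
    simp only [MonoidHom.id_apply, blk_smul, blk_blockOp]; rfl
  map_mul' m n := blk_ext fun y y' => by
    simp only [blk_mul, blk_blockOp]
    change ((∑ k, m.1 y k * n.1 k y' : A.toStarSubalgebra) : Op H) = _
    rw [AddSubmonoidClass.coe_finsetSum]; rfl
  map_star' m := blk_ext fun y y' => by simp only [blk_star, blk_blockOp]; rfl

theorem blk_blockHom (m : α.coefficients) (y y' : Mor V) : blk (α.blockHom m) y y' = m.1 y y' :=
  blk_blockOp _ _ _

theorem blockHom_injective : Function.Injective α.blockHom := fun m n h =>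
  Subtype.ext (Matrix.ext fun y y' => Subtype.ext (by
    rw [← blk_blockHom, ← blk_blockHom, h]))

theorem blk_op_one_mul_mul (Y : Op (Amp H (Mor V))) (y y' : Mor V) :
    blk (α.op 1 * Y * α.op 1) y y' = ((b (dirac y.r) : A.toStarSubalgebra) : Op H) * blk Y y y' *
      ((b (dirac y'.r) : A.toStarSubalgebra) : Op H) := by
  simp [blk_mul, blk_op, α.comp_one]

theorem range_blockHom : Set.range α.blockHom = α.weylCorner := by
  ext X
  constructor
  · rintro ⟨m, rfl⟩
    refine ⟨α.blockHom m, ?_, blk_ext fun y y' => ?_⟩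
    -- `E t t'` is the matrix unit of `l²(𝒢)`; it lies in the Weyl algebra if `r(t) = r(t')`, and
    -- otherwise its coefficient is `0`.
    · let E : Mor V → Mor V → Op (l2 (Mor V)) := fun t t' =>
        (blockOp fun x x' => if x = t ∧ x' = t' then 1 else 0 : Op (Amp ℂ (Mor V)))
      have hE : ∀ t t' x x', entry (E t t') x x' = if x = t ∧ x' = t' then 1 else 0 := by
        intro t t' x x'
        rw [entry_eq_blk, blk_blockOp]
        split_ifs <;> rfl
      have hsum : α.blockHom m = ∑ t, ∑ t', tens (m.1 t t' : Op H) (E t t') := by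
        refine blk_ext fun x x' => ?_
        simp only [blk_sum, blk_tens, hE, blk_blockHom]
        rw [Finset.sum_eq_single x, Finset.sum_eq_single x']
        · simp
        · intro t' _ ht'; simp [ht'.symm]
        · simp
        · intro t _ ht; simp [ht.symm]
        · simp
      rw [hsum]
      refine sum_mem fun t _ => sum_mem fun t' _ => ?_
      by_cases h : t.r = t'.r
      · refine subset_vNGen _ ⟨_, (m.1 t t').2, _, mem_Weyl_iff.2 fun x x' hx => ?_, rfl⟩
        rw [hE, if_neg]
        rintro ⟨rfl, rfl⟩
        exact hx h
      · rw [apply_eq_zero_of_mem m.2 h]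
        have : tens ((0 : A.toStarSubalgebra) : Op H) (E t t') = 0 := blk_ext fun x x' => by
          rw [blk_tens]; exact smul_zero _
        rw [this]
        exact zero_mem _
    · rw [blk_op_one_mul_mul, blk_blockHom]
      have h : b (dirac y.r) * m.1 y y' * b (dirac y'.r) = m.1 y y' := by
        rw [α.base_mul, (m.2 y y').1, α.mul_base, (m.2 y y').2]
      exact congrArg Subtype.val h.symm
  · rintro ⟨Y, hY, rfl⟩
    have hY' : Y ∈ rangeDiagonal V A := vNTensor_Weyl_le hY
    let m : Matrix (Mor V) (Mor V) A.toStarSubalgebra := fun y y' =>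
      b (dirac y.r) * ⟨blk Y y y', (hY' y y').1⟩ * b (dirac y'.r)
    have hm : m ∈ α.coefficients := by
      intro y y'
      have hidem : ∀ u, b (dirac u) * b (dirac u) = b (dirac u) := fun u => by
        rw [← map_mul]; congr 1; funext v; simp [dirac]
      constructor
      · rw [← α.base_mul]; simp only [m]; rw [← mul_assoc, ← mul_assoc, hidem]
      · rw [← α.mul_base]; simp only [m]; rw [mul_assoc, hidem]
    refine ⟨⟨m, hm⟩, blk_ext fun y y' => ?_⟩
    rw [blk_op_one_mul_mul, blk_blockHom]
    rfl

end RightAction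

end Corner

/-! ### The double crossed product -/

section DoubleCrossedProduct

open Mor (IsProd one)

variable {V : Type*} [Groupoid V] [Finite V] [∀ u v : V, Finite (u ⟶ v)]
  {H : Type*} [NormedAddCommGroup H] [InnerProductSpace ℂ H] [CompleteSpace H]
  {A : VonNeumannAlgebra H} {b : (V → ℂ) →⋆ₐ[ℂ] A.toStarSubalgebra} (α : RightAction A b)

namespace RightAction

/-- The entries of the dual coaction: `Ĩ` moves `(x, z)` to `(x, z x)`. -/
theorem blk₂_dualCoaction_eq_sum (X : Op (Amp H (Mor V))) (p q : Mor V × Mor V) :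
    blk₂ (dualCoaction X) p q = ∑ z : Mor V,
      if IsProd z p.1 p.2 ∧ IsProd z q.1 q.2 then blk X p.1 q.1 else 0 := by
  have h1 : ∀ k : Mor V × Mor V, blk₂ (leg23 (mpiTilde V) * tens X 1) p k =
      if IsProd k.2 p.1 p.2 then blk X p.1 k.1 else 0 := by
    intro k
    rw [blk₂_mul, Finset.sum_eq_single (p.1, k.2)]
    · rw [blk₂_leg23, blk₂_tens, entry_mpiTilde, entry_one]
      by_cases h : IsProd k.2 p.1 p.2 <;> simp [h]
    · intro l _ hl
      rw [blk₂_leg23, blk₂_tens, entry_mpiTilde, entry_one]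
      by_cases hl1 : p.1 = l.1
      · have hl2 : l.2 ≠ k.2 := fun e => hl (Prod.ext hl1.symm e)
        simp [hl2]
      · simp [hl1]
    · simp
  rw [dualCoaction, blk₂_mul, Fintype.sum_prod_type_right]
  refine Finset.sum_congr rfl fun z _ => ?_
  rw [Finset.sum_eq_single q.1]
  · rw [h1, blk₂_star, blk₂_leg23, entry_mpiTilde]
    by_cases hp : IsProd z p.1 p.2 <;> by_cases hq : IsProd z q.1 q.2 <;> simp [hp, hq]
  · intro x _ hx
    rw [blk₂_star, blk₂_leg23, entry_mpiTilde]
    simp [hx.symm]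
  · simp

/-- The dual coaction copies `X` onto each fibre over `w = x y⁻¹`; here `z = w⁻¹`. -/
theorem blk₂_dualCoaction (X : Op (Amp H (Mor V))) {w : Mor V} {p q : Mor V × Mor V}
    (hp : IsProd w p.2 p.1) (hq : IsProd w q.2 q.1) :
    blk₂ (dualCoaction X) p q = blk X p.1 q.1 := by
  rw [blk₂_dualCoaction_eq_sum, Finset.sum_eq_single w.inv, if_pos ⟨hp.inv_left, hq.inv_left⟩]
  · intro z _ hz
    exact if_neg fun h => hz (h.1.unique_left hp.inv_left)
  · simp

theorem blk₂_dualCoaction_eq_zero (X : Op (Amp H (Mor V))) {p q : Mor V × Mor V}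
    (h : ∀ w, IsProd w p.2 p.1 → ¬ IsProd w q.2 q.1) : blk₂ (dualCoaction X) p q = 0 := by
  rw [blk₂_dualCoaction_eq_sum]
  exact Finset.sum_eq_zero fun z _ => if_neg fun h' => h z.inv h'.1.inv_left h'.2.inv_left

theorem eq_dualCoaction {X : Op (Amp H (Mor V))} {Y : Op (Amp (Amp H (Mor V)) (Mor V))}
    (h1 : ∀ w p q, IsProd w p.2 p.1 → IsProd w q.2 q.1 → blk₂ Y p q = blk X p.1 q.1)
    (h2 : ∀ p q, (∀ w, IsProd w p.2 p.1 → ¬ IsProd w q.2 q.1) → blk₂ Y p q = 0) :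
    Y = dualCoaction X := by
  refine blk₂_ext fun p q => ?_
  by_cases h : ∃ w, IsProd w p.2 p.1 ∧ IsProd w q.2 q.1
  · obtain ⟨w, hp, hq⟩ := h
    rw [h1 w p q hp hq, blk₂_dualCoaction X hp hq]
  · push Not at h
    rw [h2 p q h, blk₂_dualCoaction_eq_zero X h]

theorem wotContinuous_dualCoaction :
    WOTContinuous (dualCoaction : Op (Amp H (Mor V)) → Op (Amp (Amp H (Mor V)) (Mor V))) := by
  refine wotContinuous_of_blk fun y y' => wotContinuous_of_blk fun x x' => ?_
  change WOTContinuous fun X => blk₂ (dualCoaction X) (x, y) (x', y')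
  by_cases h : ∃ w, IsProd w y x ∧ IsProd w y' x'
  · obtain ⟨w, hp, hq⟩ := h
    have := fun X : Op (Amp H (Mor V)) => blk₂_dualCoaction X (p := (x, y)) (q := (x', y')) hp hq
    simp only [this]
    exact wotContinuous_blk x x'
  · push Not at h
    have := fun X : Op (Amp H (Mor V)) =>
      blk₂_dualCoaction_eq_zero X (p := (x, y)) (q := (x', y')) h
    simp only [this]
    exact wotContinuous_const 0

/-- The dual coaction is multiplicative on the operators that commute with the `1 ⊗ (n ∘ r)`, as
these commute with the initial projection of `Ĩ₂₃`. -/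
theorem dualCoaction_mul {X Y : Op (Amp H (Mor V))}
    (hY : ∀ x x' : Mor V, x.r ≠ x'.r → blk Y x x' = 0) :
    dualCoaction X * dualCoaction Y = dualCoaction (X * Y) := by
  refine eq_dualCoaction (fun w p q hp hq => ?_) fun p q h => ?_
  · rw [blk₂_mul, blk_mul, Fintype.sum_prod_type]
    refine Finset.sum_congr rfl fun x _ => ?_
    by_cases hx : x.r = w.r
    · obtain ⟨y, hy⟩ := Mor.exists_isProd_right hx
      rw [Finset.sum_eq_single y, blk₂_dualCoaction X hp (q := (x, y)) hy,
        blk₂_dualCoaction Y (p := (x, y)) hy hq]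
      · intro y' _ hne
        rw [blk₂_dualCoaction_eq_zero X, zero_mul]
        intro w' hw' hx'
        exact hne ((hp.unique_left hw' ▸ hx').unique_right hy)
      · simp
    · rw [hY x q.1 (hq.r_eq ▸ hx), mul_zero]
      refine Finset.sum_eq_zero fun y _ => ?_
      rw [blk₂_dualCoaction_eq_zero X, zero_mul]
      intro w' hw' hx'
      exact hx (hx'.r_eq.trans (congrArg Mor.r (hw'.unique_left hp)))
  · rw [blk₂_mul]
    refine Finset.sum_eq_zero fun k _ => ?_
    by_cases hk : ∃ w, IsProd w p.2 p.1 ∧ IsProd w k.2 k.1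
    · obtain ⟨w, hw, hwk⟩ := hk
      rw [blk₂_dualCoaction_eq_zero Y (p := k), mul_zero]
      intro w' hw' hq
      exact h w hw (hw'.unique_left hwk ▸ hq)
    · push Not at hk
      rw [blk₂_dualCoaction_eq_zero X hk, zero_mul]

theorem dualCoaction_add (X Y : Op (Amp H (Mor V))) :
    dualCoaction X + dualCoaction Y = dualCoaction (X + Y) :=
  eq_dualCoaction (fun w p q hp hq => by
    rw [blk₂_add, blk₂_dualCoaction X hp hq, blk₂_dualCoaction Y hp hq, blk_add]) fun p q h => by
    rw [blk₂_add, blk₂_dualCoaction_eq_zero X h, blk₂_dualCoaction_eq_zero Y h, add_zero]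

theorem dualCoaction_smul (c : ℂ) (X : Op (Amp H (Mor V))) :
    c • dualCoaction X = dualCoaction (c • X) :=
  eq_dualCoaction (fun w p q hp hq => by
    rw [blk₂_smul, blk₂_dualCoaction X hp hq, blk_smul]) fun p q h => by
    rw [blk₂_smul, blk₂_dualCoaction_eq_zero X h, smul_zero]

theorem dualCoaction_star (X : Op (Amp H (Mor V))) :
    star (dualCoaction X) = dualCoaction (star X) :=
  eq_dualCoaction (fun w p q hp hq => by
    rw [blk₂_star, blk₂_dualCoaction X hq hp, blk_star]) fun p q h => by
    rw [blk₂_star, blk₂_dualCoaction_eq_zero X fun w h1 h2 => h w h2 h1, star_zero]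

theorem dualCoaction_eq_inflate {X : Op (Amp H (Mor V))}
    {m : Matrix (Mor V) (Mor V) A.toStarSubalgebra}
    (h : ∀ w x y x' y', IsProd w y x → IsProd w y' x' → blk X x x' = α.comp w (m y y')) :
    dualCoaction X = α.inflate m :=
  α.eq_inflate (fun w p q hp hq => by
    rw [blk₂_dualCoaction X hp hq, h w p.1 p.2 q.1 q.2 hp hq])
    fun p q h => blk₂_dualCoaction_eq_zero X h

theorem comp_base_of_isProd {w x y : Mor V} (h : IsProd w y x) :
    α.comp w (b (dirac y.r)) = b (dirac x.r) := by
  rw [comp_base, h.r_eq]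
  simp [dirac, h.s_eq_r]

theorem comp_one_base (u : V) : α.comp (one u) (b (dirac u)) = b (dirac u) :=
  α.comp_base_of_isProd (one u).isProd_one_left

theorem diagonal_mem_coefficients {d : Mor V → A.toStarSubalgebra}
    (hd : ∀ y, α.comp (one y.r) (d y) = d y) : Matrix.diagonal d ∈ α.coefficients := by
  intro y y'
  by_cases h : y = y'
  · subst h
    simp [hd]
  · simp [h]

/-- The matrix of `δ(a)`. -/
def opMatrix (a : A.toStarSubalgebra) : α.coefficients :=
  ⟨Matrix.diagonal fun y => α.comp y a,
    α.diagonal_mem_coefficients fun y => α.comp_one_comp y a⟩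

theorem inflateHom_opMatrix (a : A.toStarSubalgebra) :
    α.inflateHom (α.opMatrix a) = dualCoaction (α.op a) := by
  refine (α.dualCoaction_eq_inflate fun w x y x' y' hx hx' => ?_).symm
  rw [blk_op, opMatrix]
  by_cases h : y = y'
  · subst h
    have hxx : x = x' := hx.unique hx'
    simp [hxx, ← α.comp_comp hx']
  · have hxx : x ≠ x' := fun e => h (hx.unique_right (e ▸ hx'))
    simp [h, hxx]

/-- The matrix of `e_{b,i}(1 ⊗ T)`, for `T` in `ℛ(𝒢)`. -/
def rhoMatrix (T : Op (l2 (Mor V))) : Matrix (Mor V) (Mor V) A.toStarSubalgebra :=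
  Matrix.of fun y y' => entry T y y' • b (dirac y.r)

/-- The operators in `ℛ(𝒢)` commute with left translations by `w`. -/
theorem entry_of_mem_RG {T : Op (l2 (Mor V))} (hT : T ∈ RG V) :
    (∀ y y' : Mor V, y.r ≠ y'.r → entry T y y' = 0) ∧
      ∀ w x y x' y' : Mor V, IsProd w y x → IsProd w y' x' → entry T x x' = entry T y y' := by
  refine ⟨fun y y' h => mem_Weyl_iff.1 (vNGen_le_Weyl (subset_vNGen _ (Or.inr hT))) y y' h,
    fun w x y x' y' hx hx' => ?_⟩
  induction hT using Submodule.span_induction with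
  | mem T h =>
    obtain ⟨g, rfl⟩ := h
    rw [entry_rho, entry_rho]
    refine if_congr ⟨fun h => ?_, fun h => ?_⟩ rfl rfl
    · obtain ⟨z, hz, hz'⟩ := hx.assoc h
      rwa [hz'.unique_right hx'] at hz
    · obtain ⟨z, hz, hz'⟩ := h.assoc' hx'
      rwa [hz.unique hx] at hz'
  | zero => simp [entry]
  | add S T _ _ hS hT =>
    have : ∀ g g', entry (S + T) g g' = entry S g g' + entry T g g' := fun _ _ => rfl
    rw [this, this, hS, hT]
  | smul c T _ hT => rw [entry_smul, entry_smul, hT]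

theorem rhoMatrix_mem {T : Op (l2 (Mor V))} (hT : T ∈ RG V) :
    rhoMatrix (b := b) T ∈ α.coefficients := by
  intro y y'
  by_cases h : y.r = y'.r
  · simp [rhoMatrix, ← h, comp_one_base]
  · simp [rhoMatrix, (entry_of_mem_RG hT).1 y y' h]

theorem dualCoaction_rho {T : Op (l2 (Mor V))} (hT : T ∈ RG V) :
    dualCoaction (eB b * tens 1 T) = α.inflate (rhoMatrix (b := b) T) := by
  refine α.dualCoaction_eq_inflate fun w x y x' y' hx hx' => ?_
  rw [blk_eB_mul_tens, (entry_of_mem_RG hT).2 w x y x' y' hx hx', rhoMatrix, Matrix.of_apply,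
    map_smul, α.comp_base_of_isProd hx]
  rfl

theorem blk₂_eBHat_mul_tens (T : Op (l2 (Mor V))) (p q : Mor V × Mor V) :
    blk₂ (eBHat b * tens 1 T) p q = if p.1 = q.1 ∧ p.1.s = p.2.s then
      entry T p.2 q.2 • ((b (dirac p.1.r) : A.toStarSubalgebra) : Op H) else 0 := by
  have h1 : ∀ k, blk₂ (eBHat b) p k = if p = k ∧ p.1.s = p.2.s then
      ((b (dirac p.1.r) : A.toStarSubalgebra) : Op H) else 0 := by
    intro k
    let _ := Fintype.ofFinite V
    have h2 : blk₂ (eBHat b) p k = ∑ u : V, entry (sOp (dirac u)) p.2 k.2 •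
        entry (sOp (dirac u)) p.1 k.1 • ((b (dirac p.1.r) : A.toStarSubalgebra) : Op H) := by
      rw [eBHat, eProj, blk₂, blk_sum, blk_sum]
      simp only [blk_tens, blk_smul, bHat, blk_eB_mul_tens]
    rw [h2]
    by_cases hk : p = k
    · subst hk
      simp [sOp, entry_mulOp, dirac, eq_comm]
    · have : p.1 ≠ k.1 ∨ p.2 ≠ k.2 := by
        by_contra! h
        exact hk (Prod.ext h.1 h.2)
      rcases this with h | h <;> simp [hk, sOp, entry_mulOp, h]
  rw [blk₂_mul, Finset.sum_eq_single p]
  · rw [h1, blk₂_tens, blk_one]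
    by_cases h : p.1 = q.1 <;> by_cases h' : p.1.s = p.2.s <;> simp [h, h']
  · intro k _ hk
    rw [h1]
    simp [hk.symm]
  · simp

/-- The matrix of `e_{b̂,î}(1 ⊗ f)`. -/
def mulMatrix (f : Mor V → ℂ) : α.coefficients :=
  ⟨Matrix.diagonal fun y => f y • b (dirac y.r),
    α.diagonal_mem_coefficients fun y => by rw [map_smul, comp_one_base]⟩

theorem inflateHom_mulMatrix (f : Mor V → ℂ) :
    α.inflateHom (α.mulMatrix f) = eBHat b * tens 1 (mulOp f) := by
  refine (α.eq_inflate (fun w p q hp hq => ?_) fun p q h => ?_).symm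
  · rw [blk₂_eBHat_mul_tens, entry_mulOp, mulMatrix]
    by_cases h : p.2 = q.2
    · have h' : p.1 = q.1 := hp.unique (h ▸ hq)
      simp [h, h', hq.s_eq, α.comp_base_of_isProd hq]
    · simp [h]
  · rw [blk₂_eBHat_mul_tens, entry_mulOp]
    by_cases h' : p.2 = q.2
    · rw [if_neg]
      rintro ⟨h1, h2⟩
      obtain ⟨w, hw⟩ := Mor.exists_isProd_left h2
      exact h w hw (h1 ▸ h' ▸ hw)
    · simp [h']

theorem exists_eq_mulOp {T : Op (l2 (Mor V))} (hT : T ∈ Set.centralizer (CG V)) :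
    ∃ f, T = mulOp f := by
  refine ⟨fun t => entry T t t, entry_ext fun t t' => ?_⟩
  rw [entry_mulOp]
  have h := congrArg (fun S => entry S t t') (hT (mulOp (dirac t)) ⟨_, rfl⟩)
  simp only [entry_mul, entry_mulOp] at h
  by_cases htt : t = t'
  · subst htt; simp
  · simpa [htt, dirac, Ne.symm htt] using h

theorem mulOp_mem_centralizer (f : Mor V → ℂ) : mulOp f ∈ Set.centralizer (CG V) := by
  rintro _ ⟨f', rfl⟩
  ext ξ t
  simp [mul_left_comm]

/-- The range condition `blk X x x' = 0` is carried along because the dual coaction is multiplicative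
only on such operators. -/
theorem dualCoaction_mem_range {X : Op (Amp H (Mor V))} (hX : X ∈ α.crossedProduct) :
    dualCoaction X ∈ NonUnitalStarAlgHom.range α.inflateHom := by
  let R : NonUnitalStarSubalgebra ℂ (Op (Amp (Amp H (Mor V)) (Mor V))) :=
    NonUnitalStarAlgHom.range α.inflateHom
  have key : (∀ x x' : Mor V, x.r ≠ x'.r → blk X x x' = 0) ∧ dualCoaction X ∈ R := by
    refine vNGen_induction (P := fun X => (∀ x x' : Mor V, x.r ≠ x'.r → blk X x x' = 0) ∧
      dualCoaction X ∈ R) ?_ ?_ ?_ ?_ ?_ ?_ ?_ hX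
    · refine IsWOTClosed.inter (s := {X | ∀ x : Mor V, X ∈ {X | ∀ x' : Mor V, X ∈
        {X | x.r ≠ x'.r → X ∈ {X | blk X x x' = 0}}}}) ?_ ?_
      · exact IsWOTClosed.iInter fun x => IsWOTClosed.iInter fun x' =>
          IsWOTClosed.setOf_imp fun _ =>
            isWOTClosed_eq (wotContinuous_blk x x') (wotContinuous_const 0)
      · exact α.isWOTClosed_range_inflateHom.preimage wotContinuous_dualCoaction
    · rintro _ (⟨a, rfl⟩ | ⟨T, hT, rfl⟩)
      · refine ⟨fun x x' h => ?_, _, α.inflateHom_opMatrix a⟩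
        rw [blk_op, if_neg]
        rintro rfl
        exact h rfl
      · refine ⟨fun x x' h => ?_, ⟨_, α.rhoMatrix_mem hT⟩, (α.dualCoaction_rho hT).symm⟩
        rw [blk_eB_mul_tens, (entry_of_mem_RG hT).1 x x' h, zero_smul]
    · refine ⟨fun x x' _ => rfl, ?_⟩
      have : dualCoaction (0 : Op (Amp H (Mor V))) = 0 := by
        rw [← zero_smul ℂ (0 : Op (Amp H (Mor V))), ← dualCoaction_smul, zero_smul]
      rw [this]
      exact zero_mem R
    · rintro X Y ⟨hX, hX'⟩ ⟨hY, hY'⟩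
      refine ⟨fun x x' h => by rw [blk_add, hX x x' h, hY x x' h, add_zero], ?_⟩
      rw [← dualCoaction_add]
      exact add_mem hX' hY'
    · rintro c X ⟨hX, hX'⟩
      refine ⟨fun x x' h => by rw [blk_smul, hX x x' h, smul_zero], ?_⟩
      rw [← dualCoaction_smul]
      exact R.smul_mem c hX'
    · rintro X Y ⟨hX, hX'⟩ ⟨hY, hY'⟩
      refine ⟨fun x x' h => ?_, ?_⟩
      · rw [blk_mul]
        refine Finset.sum_eq_zero fun k _ => ?_
        by_cases hk : x.r = k.r
        · rw [hY k x' (hk ▸ h), mul_zero]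
        · rw [hX x k hk, zero_mul]
      · rw [← dualCoaction_mul hY]
        exact mul_mem hX' hY'
    · rintro X ⟨hX, hX'⟩
      refine ⟨fun x x' h => by rw [blk_star, hX x' x h.symm, star_zero], ?_⟩
      rw [← dualCoaction_star]
      exact star_mem hX'
  exact key.2

theorem single_mem_coefficients (m : α.coefficients) (t t' : Mor V) :
    Matrix.single t t' (m.1 t t') ∈ α.coefficients := by
  intro y y'
  by_cases h : t = y ∧ t' = y'
  · obtain ⟨rfl, rfl⟩ := h
    simpa using m.2 t t'
  · simp [h]

/-- A coefficient matrix with a single entry, at `(t, t')`, is the product of the matrices of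
`δ_t ∈ C(𝒢)`, of an element of `A`, and of `ρ(t⁻¹ t')`. -/
theorem inflateHom_single_mem (m : α.coefficients) (t t' : Mor V) :
    α.inflateHom ⟨_, α.single_mem_coefficients m t t'⟩ ∈ α.doubleCrossedProduct := by
  by_cases hr : t'.r = t.r
  · obtain ⟨g, hg⟩ := Mor.exists_isProd_right hr
    have hT : rho g ∈ RG V := Submodule.subset_span ⟨g, rfl⟩
    let a := α.comp t.inv (m.1 t t')
    have ha : α.comp t a = m.1 t t' := by
      have h1 : IsProd t t.inv (one t.r) := t.isProd_one_left.inv_right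
      rw [α.comp_comp h1, (m.2 t t').1]
    have hprod : (⟨_, α.single_mem_coefficients m t t'⟩ : α.coefficients) =
        α.mulMatrix (dirac t) * α.opMatrix a * ⟨_, α.rhoMatrix_mem hT⟩ := by
      refine Subtype.ext (Matrix.ext fun y y' => ?_)
      change _ = (Matrix.diagonal _ * Matrix.diagonal _ * rhoMatrix (rho g) :
        Matrix (Mor V) (Mor V) A.toStarSubalgebra) y y'
      rw [Matrix.diagonal_mul_diagonal, Matrix.diagonal_mul, rhoMatrix, Matrix.of_apply, entry_rho]
      by_cases hy : t = y
      · subst hy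
        by_cases hy' : t' = y'
        · subst hy'
          simp only [dirac, hg, if_true, one_smul, Matrix.single_apply, and_self]
          change _ = b (dirac t.r) * α.comp t a * b (dirac t.r)
          rw [ha, α.base_mul, (m.2 t t').1, α.mul_base, (m.2 t t').1]
        · have : ¬ IsProd t g y' := fun h => hy' (hg.unique h)
          simp [hy', this]
      · simp [hy, dirac, Ne.symm hy]
    rw [hprod, map_mul, map_mul, inflateHom_mulMatrix, inflateHom_opMatrix]
    refine mul_mem (mul_mem ?_ ?_) ?_
    · exact subset_vNGen _ (Or.inr ⟨_, mulOp_mem_centralizer _, rfl⟩)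
    · exact subset_vNGen _ (Or.inl ⟨_, subset_vNGen _ (Or.inl ⟨a, rfl⟩), rfl⟩)
    · exact subset_vNGen _ (Or.inl ⟨_, subset_vNGen _ (Or.inr ⟨_, hT, rfl⟩),
        α.dualCoaction_rho hT⟩)
  · have : (⟨_, α.single_mem_coefficients m t t'⟩ : α.coefficients) = 0 := Subtype.ext
      ((congrArg (Matrix.single t t') (apply_eq_zero_of_mem m.2 (Ne.symm hr))).trans
        (Matrix.single_zero _ _))
    rw [this, map_zero]
    exact zero_mem_of_op _

theorem range_inflateHom : Set.range α.inflateHom = α.doubleCrossedProduct := by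
  refine Set.Subset.antisymm ?_ ?_
  · rintro _ ⟨m, rfl⟩
    have : m = ∑ t, ∑ t', ⟨_, α.single_mem_coefficients m t t'⟩ := Subtype.ext (by
      simp only [AddSubmonoidClass.coe_finsetSum]
      exact Matrix.matrix_eq_sum_single m.1)
    rw [this, map_sum]
    refine sum_mem fun t _ => ?_
    rw [map_sum]
    exact sum_mem fun t' _ => α.inflateHom_single_mem m t t'
  · refine vNGen_le (M := NonUnitalStarAlgHom.range α.inflateHom) α.isWOTClosed_range_inflateHom ?_
    rintro _ (⟨X, hX, rfl⟩ | ⟨T, hT, rfl⟩)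
    · exact α.dualCoaction_mem_range hX
    · obtain ⟨f, rfl⟩ := exists_eq_mulOp hT
      exact ⟨_, α.inflateHom_mulMatrix f⟩

end RightAction

theorem nonempty_starAlgEquiv_of_range {B : Type*} [NonUnitalSemiring B] [Star B] [Module ℂ B]
    {K : Type*} [NormedAddCommGroup K] [InnerProductSpace ℂ K] [CompleteSpace K]
    {φ : B →⋆ₙₐ[ℂ] Op K} (hφ : Function.Injective φ) {M : NonUnitalStarSubalgebra ℂ (Op K)}
    (hM : Set.range φ = M) : Nonempty (B ≃⋆ₐ[ℂ] M) := by
  have hmem : ∀ x, φ x ∈ M := fun x => hM.subset ⟨x, rfl⟩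
  refine ⟨StarAlgEquiv.ofBijective (NonUnitalStarAlgHom.codRestrict φ M hmem) ⟨?_, ?_⟩⟩
  · exact fun x y h => hφ (congrArg Subtype.val h)
  · rintro ⟨X, hX⟩
    obtain ⟨x, rfl⟩ := hM.superset hX
    exact ⟨x, rfl⟩

theorem vnIsomorphic_of_range {B : Type*} [NonUnitalSemiring B] [Star B] [Module ℂ B]
    {K L : Type*} [NormedAddCommGroup K] [InnerProductSpace ℂ K] [CompleteSpace K]
    [NormedAddCommGroup L] [InnerProductSpace ℂ L] [CompleteSpace L]
    {φ : B →⋆ₙₐ[ℂ] Op K} {ψ : B →⋆ₙₐ[ℂ] Op L} (hφ : Function.Injective φ)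
    (hψ : Function.Injective ψ) {M : NonUnitalStarSubalgebra ℂ (Op K)}
    {N : NonUnitalStarSubalgebra ℂ (Op L)} (hM : Set.range φ = M) (hN : Set.range ψ = N) :
    VNIsomorphic M N := by
  obtain ⟨e⟩ := nonempty_starAlgEquiv_of_range hφ hM
  obtain ⟨f⟩ := nonempty_starAlgEquiv_of_range hψ hN
  exact ⟨e.symm.trans f⟩

end DoubleCrossedProduct

end QGpd

end

theorem theorem3p4 {V : Type*} [CategoryTheory.Groupoid V] [Finite V]
    [∀ u v : V, Finite (u ⟶ v)]
    {H : Type*} [NormedAddCommGroup H] [InnerProductSpace ℂ H] [CompleteSpace H]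
    (A : VonNeumannAlgebra H) (b : (V → ℂ) →⋆ₐ[ℂ] A.toStarSubalgebra)
    (hb : Function.Injective b) (α : QGpd.RightAction A b) :
    QGpd.VNIsomorphic α.doubleCrossedProduct α.weylCorner ∧
    (QGpd.Weyl V : Set (QGpd.Op (QGpd.l2 (QGpd.Mor V)))) =
      QGpd.vNGen (QGpd.CG V ∪ QGpd.RG V) ∧
    (QGpd.Weyl V : Set (QGpd.Op (QGpd.l2 (QGpd.Mor V)))) =
      Submodule.span ℂ {X | ∃ S ∈ QGpd.CG V, ∃ T ∈ QGpd.RG V, X = S * T} := by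
  exact ⟨QGpd.vnIsomorphic_of_range α.inflateHom_injective α.blockHom_injective
      α.range_inflateHom α.range_blockHom,
    (QGpd.Weyl_le_span.trans QGpd.span_le_vNGen).antisymm QGpd.vNGen_le_Weyl,
    QGpd.Weyl_le_span.antisymm (QGpd.span_le_vNGen.trans QGpd.vNGen_le_Weyl)⟩
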